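/- Let $m,n\ge 1$. For an integer $m\times n$ matrix $A$ let $\Sigma_{22}(A)$ be the $(m-1)\times(n-1)$ matrix of the sums of $A$ over all $2\times 2$ windows, $\Sigma_{22}(A)_{ij}=A_{i,j}+A_{i+1,j}+A_{i,j+1}+A_{i+1,j+1}$. The problem with $2\times 2$ window and upper constraints is: given an integer $m\times n$ matrix $U$ and an integer $(m-1)\times(n-1)$ matrix $S$, find an integer $m\times n$ matrix $A$ with $0\le A_{ij}\le U_{ij}$ for all $i,j$ and $\Sigma_{22}(A)=S$, or establish that there is none. Consider a RAM with integer registers and memory cells indexed by the natural numbers, whose instructions (each of cost $1$) are: loading a constant, addition and subtraction of registers, indirect load and store, unconditional jumps, jumps on a positive or on a zero register, and halting. Initially two registers contain $m$ and $n$, the memory contains $U$ and $S$ row by row, and everything else is $0$. Then there is a program, with constants independent of the instance, that solves the problem on every instance in $$O\bigl(mn(m+n)(1+\max(U_{\min},0))\bigr)$$ steps, where $U_{\min}=\min_{i,j}U_{ij}$; for $U\ge 0$ this is $O(mn(m+n)(1+U_{\min}))$. Throughout the computation all numbers in registers and memory have $O(\log(m+n+\max_{i,j}|U_{ij}|+\max_{i,j}|S_{ij}|))$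 bits. In particular, the running time is bounded by a polynomial in the length of the input when the entries of $U$ are written in unary (and those of $S$ in binary). -/

import Mathlib

namespace WindowSums

/-! ### The reconstruction problem -/

/-- The matrix of sums of `A` over all `m' × n'` windows. It has `m - m' + 1` rows and
`n - n' + 1` columns (none at all if the window does not fit). -/
def windowSum {m n : ℕ} (m' n' : ℕ) (A : Matrix (Fin m) (Fin n) ℤ) :
    Matrix (Fin (m + 1 - m')) (Fin (n + 1 - n')) ℤ :=
  fun i j => ∑ a : Fin m', ∑ b : Fin n',
    A ⟨i.1 + a.1, by have := i.2; have := a.2; omega⟩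
      ⟨j.1 + b.1, by have := j.2; have := b.2; omega⟩

/-- `A` solves the problem with `2 × 2` window, sums `S` and upper constraints `U`. -/
def IsSolution {m n : ℕ} (U : Matrix (Fin m) (Fin n) ℤ)
    (S : Matrix (Fin (m + 1 - 2)) (Fin (n + 1 - 2)) ℤ) (A : Matrix (Fin m) (Fin n) ℤ) : Prop :=
  (∀ i j, 0 ≤ A i j ∧ A i j ≤ U i j) ∧ windowSum 2 2 A = S

/-- The least entry of a nonempty integer matrix. -/
def minEntry {m n : ℕ} (hm : 0 < m) (hn : 0 < n) (U : Matrix (Fin m) (Fin n) ℤ) : ℤ :=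
  (Finset.univ : Finset (Fin m × Fin n)).inf' ⟨(⟨0, hm⟩, ⟨0, hn⟩), Finset.mem_univ _⟩
    (fun ij => U ij.1 ij.2)

/-- The largest absolute value of an entry (`0` for an empty matrix). -/
def maxAbs {m n : ℕ} (A : Matrix (Fin m) (Fin n) ℤ) : ℕ :=
  (Finset.univ : Finset (Fin m × Fin n)).sup (fun ij => (A ij.1 ij.2).natAbs)

/-! ### Random access machine -/

/-- Instructions of the machine. `d`, `a`, `b`, `s` are numbers of registers and `l` is the
number of an instruction. -/
inductive Instr
  /-- `reg d := k` -/
  | const (d : ℕ) (k : ℤ)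
  /-- `reg d := reg a + reg b` -/
  | add (d a b : ℕ)
  /-- `reg d := reg a - reg b` -/
  | sub (d a b : ℕ)
  /-- `reg d := mem (reg a)` -/
  | load (d a : ℕ)
  /-- `mem (reg a) := reg s` -/
  | store (a s : ℕ)
  /-- go to instruction `l` -/
  | jump (l : ℕ)
  /-- go to instruction `l` if `reg a > 0` -/
  | jumpPos (a l : ℕ)
  /-- go to instruction `l` if `reg a = 0` -/
  | jumpZero (a l : ℕ)
  /-- stop -/
  | halt

/-- A program is a finite list of instructions, numbered from `0`. It can therefore mention
only finitely many registers; unbounded storage is reached through `load` and `store`. -/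
abbrev Program := List Instr

/-- A configuration: program counter, registers, and memory cells. -/
structure Config where
  pc : ℕ
  reg : ℕ → ℤ
  mem : ℕ → ℤ

/-- Execution of one instruction. There is no next configuration after `halt`, after leaving
the program, and after an access to a negative address. -/
def step (p : Program) (c : Config) : Option Config :=
  match p[c.pc]? with
  | none => none
  | some .halt => none
  | some (.const d k) => some ⟨c.pc + 1, Function.update c.reg d k, c.mem⟩
  | some (.add d a b) => some ⟨c.pc + 1, Function.update c.reg d (c.reg a + c.reg b), c.mem⟩
  | some (.sub d a b) => some ⟨c.pc + 1, Function.update c.reg d (c.reg a - c.reg b), c.mem⟩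
  | some (.load d a) =>
      if 0 ≤ c.reg a then
        some ⟨c.pc + 1, Function.update c.reg d (c.mem (c.reg a).toNat), c.mem⟩
      else none
  | some (.store a s) =>
      if 0 ≤ c.reg a then
        some ⟨c.pc + 1, c.reg, Function.update c.mem (c.reg a).toNat (c.reg s)⟩
      else none
  | some (.jump l) => some ⟨l, c.reg, c.mem⟩
  | some (.jumpPos a l) => some ⟨if 0 < c.reg a then l else c.pc + 1, c.reg, c.mem⟩
  | some (.jumpZero a l) => some ⟨if c.reg a = 0 then l else c.pc + 1, c.reg, c.mem⟩

/-- The configuration after `t` executed instructions, if there is one. -/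
def run (p : Program) (c : Config) : ℕ → Option Config
  | 0 => some c
  | t + 1 => (run p c t).bind (step p)

/-- Every register and every memory cell holds a signed `w`-bit number. -/
def Config.FitsIn (c : Config) (w : ℕ) : Prop :=
  (∀ r, |c.reg r| < 2 ^ w) ∧ (∀ a, |c.mem a| < 2 ^ w)

/-- Started in `c`, the program arrives at a `halt` instruction in configuration `c'` after
executing exactly `T` instructions, and all numbers that occur on the way fit into words of
`w` bits (and a sign). -/
def HaltsIn (p : Program) (w : ℕ) (c : Config) (T : ℕ) (c' : Config) : Prop :=
  run p c T = some c' ∧ p[c'.pc]? = some .halt ∧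
    ∀ t ≤ T, ∀ d, run p c t = some d → d.FitsIn w

/-! ### Input and output -/

/-- The initial memory: the entries of `U` row by row in cells `0, …, mn - 1`, the entries of
`S` row by row in the following cells, and zeros elsewhere. -/
def inputMem {m n k l : ℕ} (U : Matrix (Fin m) (Fin n) ℤ) (S : Matrix (Fin k) (Fin l) ℤ)
    (a : ℕ) : ℤ :=
  if h : a < m * n then U (Fin.divNat ⟨a, h⟩) (Fin.modNat ⟨a, h⟩)
  else if h' : a - m * n < k * l then
    S (Fin.divNat ⟨a - m * n, h'⟩) (Fin.modNat ⟨a - m * n, h'⟩)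
  else 0

/-- The initial configuration: `m` and `n` in registers `0` and `1`, zeros in the other
registers, `U` and `S` in the memory. -/
def inputConfig {m n : ℕ} (U : Matrix (Fin m) (Fin n) ℤ)
    (S : Matrix (Fin (m + 1 - 2)) (Fin (n + 1 - 2)) ℤ) : Config where
  pc := 0
  reg := fun r => if r = 0 then (m : ℤ) else if r = 1 then (n : ℤ) else 0
  mem := inputMem U S

/-- The `m × n` matrix stored row by row in cells `0, …, mn - 1`. -/
def outputMatrix (m n : ℕ) (c : Config) : Matrix (Fin m) (Fin n) ℤ :=
  fun i j => c.mem (i.1 * n + j.1)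

/-- The final configuration answers the instance `(U, S)`: either register `0` contains `1` and
the memory contains a solution, or register `0` contains `0` and there is no solution. -/
def Answers {m n : ℕ} (U : Matrix (Fin m) (Fin n) ℤ)
    (S : Matrix (Fin (m + 1 - 2)) (Fin (n + 1 - 2)) ℤ) (c : Config) : Prop :=
  (c.reg 0 = 1 ∧ IsSolution U S (outputMatrix m n c)) ∨
    (c.reg 0 = 0 ∧ ¬ ∃ A, IsSolution U S A)

/-- The number of bits of the largest number among `m + n` and the entries of `U` and `S`, up to
a constant factor. -/
def instanceBits {m n : ℕ} (U : Matrix (Fin m) (Fin n) ℤ)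
    (S : Matrix (Fin (m + 1 - 2)) (Fin (n + 1 - 2)) ℤ) : ℕ :=
  Nat.size (m + n + maxAbs U + maxAbs S)

/-- The length of the instance when the entries of `U` are written in unary and those of `S` in
binary, with one separator per entry. -/
def unaryLength {m n : ℕ} (U : Matrix (Fin m) (Fin n) ℤ)
    (S : Matrix (Fin (m + 1 - 2)) (Fin (n + 1 - 2)) ℤ) : ℕ :=
  (∑ i, ∑ j, ((U i j).natAbs + 1)) + ∑ i, ∑ j, (Nat.size (S i j).natAbs + 1)

end WindowSums

/-!
Two matrices with the same window sums differ by alternating row and column offsets, so a solution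
is a particular matrix with the window sums `S` plus such offsets. Replacing `A i j` by
`U i j - A i j` at even positions `i + j` preserves the bounds and removes the alternating signs,
and the row offsets can be eliminated: row offsets within the bounds exist if and only if the column
offsets `d` satisfy the difference constraints `d j' ≤ d j + (u i j - u i j' + U i j')` for all `i`,
`j`, `j'`. These `mn²` constraints can be relaxed row by row in `O(mn)` steps, because all
constraints that come from row `i` are expressed by the minimum of `u i j + d j` over `j`. If the
constraints are solvable, then there is a greatest nonpositive solution, and every round of
relaxation that starts above it brings at least one more column offset to its final value: otherwise
the solution could be increased by `1` wherever it differs from the current offsets. So `n` rounds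
suffice, and the running time `O(mn²)` does not depend on `U`.
-/

namespace WindowSums

/-! ### Potentials -/

section Potential

variable {ι : Type*} {E : ι → ι → ℤ → Prop} {d d' : ι → ℤ}

/-- A solution of the system of difference constraints `d j ≤ d i + w`, one for every edge from `i`
to `j` of weight `w`. The edges form a relation because parallel edges occur. -/
def IsPotential (E : ι → ι → ℤ → Prop) (d : ι → ℤ) : Prop :=
  ∀ i j w, E i j w → d j ≤ d i + w

theorem IsPotential.sup (h : IsPotential E d) (h' : IsPotential E d') : IsPotential E (d ⊔ d') := by
  intro i j w hw
  rw [Pi.sup_apply, Pi.sup_apply, max_add]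
  exact max_le_max (h i j w hw) (h' i j w hw)

theorem IsPotential.sub_const (h : IsPotential E d) (K : ℤ) : IsPotential E (fun i => d i - K) := by
  intro i j w hw
  linarith [h i j w hw]

theorem exists_isGreatest_isPotential [Finite ι] (hE : ∃ d, IsPotential E d) :
    ∃ d, IsGreatest {d | IsPotential E d ∧ d ≤ 0} d := by
  have := Fintype.ofFinite ι
  obtain ⟨d₀, hd₀⟩ := hE
  have hshift : (fun i => d₀ i - ∑ j, |d₀ j|) ≤ 0 := fun i => sub_nonpos.2 <|
    (le_abs_self _).trans <|
      Finset.single_le_sum (f := fun j => |d₀ j|) (fun _ _ => abs_nonneg _) (Finset.mem_univ i)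
  obtain ⟨_, ⟨d, hd, hneg, rfl⟩, hmax⟩ := Int.exists_greatest_of_bdd
    (P := fun z => ∃ d, IsPotential E d ∧ d ≤ 0 ∧ ∑ i, d i = z)
    ⟨0, fun _ ⟨_, _, hneg, hz⟩ => hz ▸ Finset.sum_nonpos fun i _ => hneg i⟩
    ⟨_, _, hd₀.sub_const _, hshift, rfl⟩
  refine ⟨d, ⟨hd, hneg⟩, fun d' ⟨hd', hneg'⟩ => ?_⟩
  have hsum : ∑ i, d i = ∑ i, (d ⊔ d') i :=
    (Finset.sum_le_sum fun i _ => le_sup_left (a := d) (b := d') i).antisymm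
      (hmax _ ⟨_, hd.sup hd', sup_le hneg hneg', rfl⟩)
  have heq := (Finset.sum_eq_sum_iff_of_le fun i _ => le_sup_left (a := d) (b := d') i).1 hsum
  exact fun i => sup_eq_left.1 (heq i (Finset.mem_univ i)).symm

-- Otherwise `d` could be increased by `1` wherever it differs from `c`.
theorem exists_settled {c c' : ι → ℤ} (hd : IsGreatest {d | IsPotential E d ∧ d ≤ 0} d)
    (hdc : d ≤ c) (hc : c ≤ 0) (hdc' : d ≤ c') (hrelax : ∀ i j w, E i j w → c' j ≤ c i + w)
    (hne : c ≠ d) : ∃ j, c j ≠ d j ∧ c' j = d j := by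
  by_contra! hno
  let e : ι → ℤ := fun i => if c i = d i then d i else d i + 1
  have he : IsPotential E e := by
    intro i j w hw
    have h1 := hd.1.1 i j w hw
    have h2 := hrelax i j w hw
    have h3 : d j ≤ c' j := hdc' j
    by_cases hi : c i = d i <;> by_cases hj : c j = d j <;>
      simp only [e, hi, hj, if_true, if_false] at h2 ⊢
    · exact h1
    · have := hno j hj
      omega
    · omega
    · omega
  have hneg : e ≤ 0 := by
    intro i
    have h1 : d i ≤ c i := hdc i
    have h2 : c i ≤ 0 := hc i
    by_cases hi : c i = d i <;> simp only [e, hi, if_true, if_false, Pi.zero_apply] <;> omega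
  obtain ⟨k, hk⟩ := Function.ne_iff.1 hne
  have := hd.2 ⟨he, hneg⟩ k
  simp only [e, if_neg hk] at this
  omega

theorem isGreatest_of_relaxation [Fintype ι] {c : ℕ → ι → ℤ} (h0 : c 0 = 0) (hanti : Antitone c)
    (hrelax : ∀ t i j w, E i j w → c (t + 1) j ≤ c t i + w)
    (hlow : ∀ d, IsPotential E d → d ≤ 0 → ∀ t, d ≤ c t) (hE : ∃ d, IsPotential E d) :
    IsGreatest {d | IsPotential E d ∧ d ≤ 0} (c (Fintype.card ι)) := by
  classical
  obtain ⟨d, hd⟩ := exists_isGreatest_isPotential hE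
  have hle : ∀ t, d ≤ c t := hlow d hd.1.1 hd.1.2
  have hstay : ∀ {t j}, c t j = d j → c (t + 1) j = d j := fun {t j} h =>
    ((hanti t.le_succ j).trans h.le).antisymm (hle _ j)
  have hsettled : ∀ t, c t = d ∨ t ≤ (Finset.univ.filter fun j => c t j = d j).card := by
    intro t
    induction t with
    | zero => exact .inr (Nat.zero_le _)
    | succ t ih =>
      by_cases hne : c t = d
      · exact .inl (funext fun j => hstay (congrFun hne j))
      obtain ⟨j, hj, hj'⟩ := exists_settled hd (hle t) (h0 ▸ hanti t.zero_le) (hle (t + 1))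
        (hrelax t) hne
      refine .inr ((ih.resolve_left hne).trans_lt (Finset.card_lt_card ?_))
      refine (Finset.ssubset_iff_of_subset (Finset.monotone_filter_right _ fun _ _ => hstay)).2
        ⟨j, ?_, ?_⟩ <;> simp [hj, hj']
  suffices c (Fintype.card ι) = d from this ▸ hd
  refine (hsettled _).elim id fun hcard => funext fun j => ?_
  exact Finset.filter_card_eq ((Finset.card_le_univ _).antisymm hcard) j (Finset.mem_univ j)

end Potential

/-! ### Relaxation row by row -/

section Relaxation

variable (m n : ℕ) (u U : ℕ → ℕ → ℤ)

/-- The difference constraints on column offsets `d`: the potentials are the `d` for which there are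
row offsets `r` with `0 ≤ u i j + d j - r i ≤ U i j` for all `i` and `j`. -/
def ColumnConstraint (j j' : Fin n) (w : ℤ) : Prop :=
  ∃ i < m, w = u i j - u i j' + U i j'

/-- The minimum of `u i 0 + c 0` and all `u i j + c j` with `j < k`; the first term provides a value
for `k = 0`. -/
def rowMin (c : ℕ → ℤ) (i : ℕ) : ℕ → ℤ
  | 0 => u i 0 + c 0
  | k + 1 => min (rowMin c i k) (u i k + c k)

/-- The column offsets after the relaxation of all constraints that come from row `i`. -/
def relaxRow (i : ℕ) (c : ℕ → ℤ) (j : ℕ) : ℤ :=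
  min (c j) (rowMin u c i n - u i j + U i j)

/-- The column offsets after the relaxation of rows `0, …, k - 1`, one after the other. -/
def relaxRows (c : ℕ → ℤ) : ℕ → ℕ → ℤ
  | 0 => c
  | k + 1 => relaxRow n u U k (relaxRows c k)

/-- The column offsets after `t` rounds of relaxation. -/
def offsets : ℕ → ℕ → ℤ
  | 0 => 0
  | t + 1 => relaxRows n u U (offsets t) m

/-- The entries of `u`, shifted by the column offsets `c` and then by the least row offsets that
make them nonnegative. -/
def slack (c : ℕ → ℤ) (i j : ℕ) : ℤ := u i j + c j - rowMin u c i n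

variable {m n u U} {c : ℕ → ℤ} {i j k : ℕ}

theorem rowMin_le (hj : j < k) : rowMin u c i k ≤ u i j + c j := by
  induction k with
  | zero => omega
  | succ k ih =>
    rcases Nat.lt_succ_iff_lt_or_eq.1 hj with h | rfl
    · exact (min_le_left _ _).trans (ih h)
    · exact min_le_right _ _

theorem exists_rowMin_eq (c : ℕ → ℤ) (i : ℕ) (hk : k ≤ n) (hn : 0 < n) :
    ∃ j < n, rowMin u c i k = u i j + c j := by
  induction k with
  | zero => exact ⟨0, hn, rfl⟩
  | succ k ih =>
    rcases min_choice (rowMin u c i k) (u i k + c k) with h | h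
    · rw [rowMin, h]
      exact ih (by omega)
    · exact ⟨k, hk, h⟩

theorem slack_nonneg (hj : j < n) : 0 ≤ slack n u c i j :=
  sub_nonneg.2 (rowMin_le hj)

theorem slack_le (hc : IsPotential (ColumnConstraint m n u U) (fun j => c j)) (hi : i < m)
    (hj : j < n) : slack n u c i j ≤ U i j := by
  obtain ⟨j', hj', hmin⟩ := exists_rowMin_eq (u := u) c i le_rfl (Nat.zero_lt_of_lt hj)
  have := hc ⟨j', hj'⟩ ⟨j, hj⟩ _ ⟨i, hi, rfl⟩
  rw [slack, hmin]
  dsimp only at this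
  linarith

theorem isPotential_columnConstraint {d r : ℕ → ℤ}
    (h : ∀ i < m, ∀ j < n, 0 ≤ u i j + d j - r i ∧ u i j + d j - r i ≤ U i j) :
    IsPotential (ColumnConstraint m n u U) (fun j => d j) := by
  rintro j j' _ ⟨i, hi, rfl⟩
  have hj := (h i hi j j.2).1
  have hj' := (h i hi j' j'.2).2
  linarith

theorem relaxRows_antitone (c : ℕ → ℤ) : Antitone (relaxRows n u U c) :=
  antitone_nat_of_succ_le fun _ _ => min_le_left _ _

theorem relaxRows_le {j' : ℕ} (c : ℕ → ℤ) (hi : i < m) (hj : j < n) :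
    relaxRows n u U c m j' ≤ c j + (u i j - u i j' + U i j') := by
  have hm : relaxRows n u U c m j' ≤ relaxRows n u U c (i + 1) j' := relaxRows_antitone c hi j'
  have hrelax : relaxRows n u U c (i + 1) j' ≤
    rowMin u (relaxRows n u U c i) i n - u i j' + U i j' := min_le_right _ _
  have hmin : rowMin u (relaxRows n u U c i) i n ≤ u i j + relaxRows n u U c i j := rowMin_le hj
  have h0 : relaxRows n u U c i j ≤ c j := relaxRows_antitone c (Nat.zero_le i) j
  linarith

theorem IsPotential.le_relaxRows {d : Fin n → ℤ} (hd : IsPotential (ColumnConstraint m n u U) d)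
    (hdc : ∀ j, d j ≤ c j) (hk : k ≤ m) (j : Fin n) : d j ≤ relaxRows n u U c k j := by
  induction k generalizing j with
  | zero => exact hdc j
  | succ k ih =>
    refine le_min (ih (by omega) j) ?_
    obtain ⟨j', hj', hmin⟩ :=
      exists_rowMin_eq (u := u) (relaxRows n u U c k) k le_rfl (Fin.pos j)
    have h1 := hd ⟨j', hj'⟩ j _ ⟨k, hk, rfl⟩
    have h2 := ih (by omega) ⟨j', hj'⟩
    rw [hmin]
    dsimp only at h1 h2
    linarith

theorem isPotential_offsets (h : ∃ d, IsPotential (ColumnConstraint m n u U) d) :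
    IsPotential (ColumnConstraint m n u U) (fun j => offsets m n u U n j) := by
  have := isGreatest_of_relaxation (c := fun t (j : Fin n) => offsets m n u U t j) rfl
    (antitone_nat_of_succ_le fun t j => relaxRows_antitone (offsets m n u U t) (Nat.zero_le m) j)
    (by rintro t j j' _ ⟨i, hi, rfl⟩; exact relaxRows_le _ hi j.2)
    (fun d hd hneg t => by
      induction t with
      | zero => exact hneg
      | succ t ih => exact hd.le_relaxRows ih le_rfl) h
  rw [Fintype.card_fin] at this
  exact this.1.1

variable {X Y : ℤ}

theorem abs_rowMin_le (hk : k ≤ n) (hn : 0 < n) (hu : ∀ j < n, |u i j| ≤ X)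
    (hc : ∀ j < n, |c j| ≤ Y) : |rowMin u c i k| ≤ X + Y := by
  obtain ⟨j, hj, h⟩ := exists_rowMin_eq (u := u) c i hk hn
  rw [h]
  exact (abs_add_le _ _).trans (add_le_add (hu j hj) (hc j hj))

theorem abs_relaxRow_le (hu : ∀ j < n, |u i j| ≤ X) (hU : ∀ j < n, |U i j| ≤ X)
    (hc : ∀ j < n, |c j| ≤ Y) (hj : j < n) : |relaxRow n u U i c j| ≤ Y + 3 * X := by
  have hmin := abs_le.1 (abs_rowMin_le le_rfl (Nat.zero_lt_of_lt hj) hu hc)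
  have hu := abs_le.1 (hu j hj)
  have hU := abs_le.1 (hU j hj)
  have hc := abs_le.1 (hc j hj)
  rw [relaxRow, abs_le]
  omega

theorem abs_relaxRows_le (hu : ∀ i < m, ∀ j < n, |u i j| ≤ X)
    (hU : ∀ i < m, ∀ j < n, |U i j| ≤ X) (hc : ∀ j < n, |c j| ≤ Y) (hk : k ≤ m) (hj : j < n) :
    |relaxRows n u U c k j| ≤ Y + k * (3 * X) := by
  induction k generalizing j with
  | zero => simpa [relaxRows] using hc j hj
  | succ k ih =>
    refine (abs_relaxRow_le (hu k hk) (hU k hk) (fun j hj => ih (by omega) hj) hj).trans_eq ?_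
    push_cast
    ring

theorem abs_offsets_le (hu : ∀ i < m, ∀ j < n, |u i j| ≤ X) (hU : ∀ i < m, ∀ j < n, |U i j| ≤ X)
    (t : ℕ) (hj : j < n) : |offsets m n u U t j| ≤ t * (m * (3 * X)) := by
  induction t generalizing j with
  | zero => simp [offsets]
  | succ t ih =>
    refine (abs_relaxRows_le hu hU (fun j hj => ih hj) le_rfl hj).trans_eq ?_
    push_cast
    ring

end Relaxation

/-! ### Reduction to difference constraints -/

section Reduction

variable {m n : ℕ} {U S A E : ℕ → ℕ → ℤ} {c : ℕ → ℤ} {i j : ℕ}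

/-- The version of `IsSolution` for matrices with indices in `ℕ`, restricted to the first `m` rows
and `n` columns. -/
structure Solves (m n : ℕ) (U S A : ℕ → ℕ → ℤ) : Prop where
  bounds : ∀ i < m, ∀ j < n, 0 ≤ A i j ∧ A i j ≤ U i j
  window : ∀ i j, i + 1 < m → j + 1 < n →
    A i j + A (i + 1) j + A i (j + 1) + A (i + 1) (j + 1) = S i j

/-- The sums of `particular S` over its `2 × 1` windows. -/
def pairSum (S : ℕ → ℕ → ℤ) (i : ℕ) : ℕ → ℤ
  | 0 => 0
  | j + 1 => S i j - pairSum S i j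

/-- The matrix with window sums `S` whose first row and first column vanish. -/
def particular (S : ℕ → ℕ → ℤ) : ℕ → ℕ → ℤ
  | 0, _ => 0
  | i + 1, j => pairSum S i j - particular S i j

/-- The matrix `a` with the entries at even positions `i + j` replaced by their distances to the
upper bounds, an involution that preserves `0 ≤ a ≤ U` and removes the alternating signs from the
row and column offsets. -/
def reflect (U a : ℕ → ℕ → ℤ) (i j : ℕ) : ℤ :=
  if Even (i + j) then U i j - a i j else a i j

/-- The matrix whose rows and columns are shifted in search of a solution. -/
def base (U S : ℕ → ℕ → ℤ) : ℕ → ℕ → ℤ := reflect U (particular S)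

/-- The matrix with window sums `S` that belongs to the column offsets `c`. -/
def candidate (n : ℕ) (U S : ℕ → ℕ → ℤ) (c : ℕ → ℤ) : ℕ → ℕ → ℤ :=
  reflect U (slack n (base U S) c)

theorem particular_window (S : ℕ → ℕ → ℤ) (i j : ℕ) :
    particular S i j + particular S (i + 1) j + particular S i (j + 1) +
      particular S (i + 1) (j + 1) = S i j := by
  simp only [particular, pairSum]
  ring

theorem reflect_reflect (U a : ℕ → ℕ → ℤ) : reflect U (reflect U a) = a := by
  funext i j
  simp only [reflect]
  split_ifs <;> omega

theorem reflect_sub_reflect (U a b : ℕ → ℕ → ℤ) (i j : ℕ) :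
    reflect U a i j - reflect U b i j = (-1) ^ i * (-1) ^ j * (b i j - a i j) := by
  rw [← pow_add, reflect, reflect]
  rcases Nat.even_or_odd (i + j) with h | h
  · rw [if_pos h, if_pos h, h.neg_one_pow]
    ring
  · rw [if_neg (Nat.not_even_iff_odd.2 h), if_neg (Nat.not_even_iff_odd.2 h), h.neg_one_pow]
    ring

theorem reflect_nonneg_and_le_iff {a : ℕ → ℕ → ℤ} :
    0 ≤ reflect U a i j ∧ reflect U a i j ≤ U i j ↔ 0 ≤ a i j ∧ a i j ≤ U i j := by
  rw [reflect]
  split_ifs <;> omega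

theorem abs_pairSum_le {X : ℤ} (hS : ∀ j, |S i j| ≤ X) (j : ℕ) : |pairSum S i j| ≤ j * X := by
  induction j with
  | zero => simp [pairSum]
  | succ j ih =>
    rw [pairSum]
    push_cast
    linarith [abs_sub (S i j) (pairSum S i j), hS j]

theorem abs_particular_le {X : ℤ} (hS : ∀ i j, |S i j| ≤ X) (i j : ℕ) :
    |particular S i j| ≤ i * (j * X) := by
  induction i with
  | zero => simp [particular]
  | succ i ih =>
    rw [particular]
    push_cast
    linarith [abs_sub (pairSum S i j) (particular S i j), abs_pairSum_le (hS i) j]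

theorem abs_base_le {X Y : ℤ} (hU : |U i j| ≤ X) (hS : |particular S i j| ≤ Y) :
    |base U S i j| ≤ X + Y := by
  have := abs_sub (U i j) (particular S i j)
  have := abs_nonneg (U i j)
  rw [base, reflect]
  split_ifs <;> omega

theorem candidate_eq (n : ℕ) (U S : ℕ → ℕ → ℤ) (c : ℕ → ℤ) (i j : ℕ) :
    candidate n U S c i j =
      particular S i j + (-1) ^ i * (-1) ^ j * (rowMin (base U S) c i n - c j) := by
  have h := reflect_sub_reflect U (slack n (base U S) c) (base U S) i j
  rw [show reflect U (base U S) = particular S from reflect_reflect U _, slack] at h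
  rw [candidate]
  linear_combination h

theorem candidate_window (n : ℕ) (U S : ℕ → ℕ → ℤ) (c : ℕ → ℤ) (i j : ℕ) :
    candidate n U S c i j + candidate n U S c (i + 1) j + candidate n U S c i (j + 1) +
      candidate n U S c (i + 1) (j + 1) = S i j := by
  simp only [candidate_eq, pow_succ]
  linear_combination particular_window S i j

theorem solves_candidate (h : ∀ i < m, ∀ j < n, slack n (base U S) c i j ≤ U i j) :
    Solves m n U S (candidate n U S c) where
  bounds i hi j hj := reflect_nonneg_and_le_iff.2 ⟨slack_nonneg hj, h i hi j hj⟩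
  window i j _ _ := candidate_window n U S c i j

theorem eq_neg_one_pow_mul_of_add_eq_zero {f : ℕ → ℤ} (hf : ∀ j, j + 1 < n → f j + f (j + 1) = 0)
    (hj : j < n) : f j = (-1) ^ j * f 0 := by
  induction j with
  | zero => simp
  | succ j ih =>
    rw [pow_succ]
    linear_combination hf j hj - ih (by omega)

theorem neg_one_pow_mul_eq_of_window_eq_zero
    (hE : ∀ i j, i + 1 < m → j + 1 < n →
      E i j + E (i + 1) j + E i (j + 1) + E (i + 1) (j + 1) = 0) (hi : i < m) (hj : j < n) :
    (-1) ^ i * (-1) ^ j * E i j = (-1) ^ i * E i 0 + (-1) ^ j * E 0 j - E 0 0 := by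
  have hsq : ((-1 : ℤ) ^ j) * (-1) ^ j = 1 := by rw [← mul_pow]; simp
  induction i with
  | zero => simp
  | succ i ih =>
    have hrow : E i j + E (i + 1) j = (-1) ^ j * (E i 0 + E (i + 1) 0) :=
      eq_neg_one_pow_mul_of_add_eq_zero (f := fun j => E i j + E (i + 1) j)
        (fun j hj => by linear_combination hE i j hi hj) hj
    rw [pow_succ]
    linear_combination ih (by omega) - (-1) ^ i * (-1) ^ j * hrow -
      (-1) ^ i * (E i 0 + E (i + 1) 0) * hsq

-- Any two matrices with the same window sums differ by alternating row and column offsets.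
theorem Solves.exists_isPotential (h : Solves m n U S A) :
    ∃ d, IsPotential (ColumnConstraint m n (base U S) U) d := by
  let E : ℕ → ℕ → ℤ := fun i j => A i j - particular S i j
  have hE : ∀ i j, i + 1 < m → j + 1 < n →
      E i j + E (i + 1) j + E i (j + 1) + E (i + 1) (j + 1) = 0 := fun i j hi hj => by
    linear_combination h.window i j hi hj - particular_window S i j
  refine ⟨_, isPotential_columnConstraint (d := fun j => E 0 0 - (-1) ^ j * E 0 j)
    (r := fun i => (-1) ^ i * E i 0) fun i hi j hj => ?_⟩
  have hreflect : base U S i j + (E 0 0 - (-1) ^ j * E 0 j) - (-1) ^ i * E i 0 =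
      reflect U A i j := by
    rw [base]
    linear_combination neg_one_pow_mul_eq_of_window_eq_zero hE hi hj -
      reflect_sub_reflect U A (particular S) i j
  rw [hreflect]
  exact reflect_nonneg_and_le_iff.2 (h.bounds i hi j hj)

theorem Solves.slack_offsets_le (h : Solves m n U S A) (hi : i < m) (hj : j < n) :
    slack n (base U S) (offsets m n (base U S) U n) i j ≤ U i j :=
  slack_le (isPotential_offsets h.exists_isPotential) hi hj

end Reduction

/-! ### A structured language for the machine -/

/-- A configuration of the machine without the program counter. -/
structure Store where
  reg : ℕ → ℤ
  mem : ℕ → ℤ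

namespace Store

/-- The configuration with store `s` and program counter `b`. -/
def withPC (s : Store) (b : ℕ) : Config := ⟨b, s.reg, s.mem⟩

/-- The store after an assignment to register `r`. -/
def setReg (s : Store) (r : ℕ) (v : ℤ) : Store := ⟨Function.update s.reg r v, s.mem⟩

/-- The store after an assignment to memory cell `a`. -/
def setMem (s : Store) (a : ℕ) (v : ℤ) : Store := ⟨s.reg, Function.update s.mem a v⟩

/-- All numbers in the store are smaller than `B` in absolute value. -/
def Bounded (B : ℤ) (s : Store) : Prop := (∀ r, |s.reg r| < B) ∧ ∀ a, |s.mem a| < B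

/-- The two stores have the same contents in all registers outside the list `l`. -/
def AgreeOff (l : List ℕ) (s s' : Store) : Prop := ∀ r ∉ l, s'.reg r = s.reg r

variable {B v : ℤ} {s : Store} {r a : ℕ}

theorem Bounded.setReg (h : s.Bounded B) (hv : |v| < B) : (s.setReg r v).Bounded B :=
  ⟨(Function.forall_update_iff s.reg fun _ x => |x| < B).2 ⟨hv, fun r' _ => h.1 r'⟩, h.2⟩

theorem Bounded.setMem (h : s.Bounded B) (hv : |v| < B) : (s.setMem a v).Bounded B :=
  ⟨h.1, (Function.forall_update_iff s.mem fun _ x => |x| < B).2 ⟨hv, fun a' _ => h.2 a'⟩⟩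

end Store

/-- Structured programs. Registers and memory cells are assigned as by the instructions of the
machine; `subIf g d a b` is the assignment `reg d := reg a - reg b`, executed only if `reg g` is
positive, and `loop k c` repeats `c` as long as `reg k` is positive. -/
inductive Cmd
  | const (d : ℕ) (k : ℤ)
  | add (d a b : ℕ)
  | sub (d a b : ℕ)
  | load (d a : ℕ)
  | store (a s : ℕ)
  | subIf (g d a b : ℕ)
  | seq (c c' : Cmd)
  | loop (k : ℕ) (c : Cmd)

infixr:60 " ;; " => Cmd.seq

namespace Cmd

/-- The number of instructions of the compiled command. -/
def len : Cmd → ℕ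
  | subIf _ _ _ _ => 3
  | seq c c' => c.len + c'.len
  | loop _ c => c.len + 3
  | _ => 1

/-- The compiled command, to be placed from instruction `b` on. -/
def code : Cmd → ℕ → List Instr
  | const d k, _ => [.const d k]
  | add d a b, _ => [.add d a b]
  | sub d a b, _ => [.sub d a b]
  | load d a, _ => [.load d a]
  | store a s, _ => [.store a s]
  | subIf g d x y, b => [.jumpPos g (b + 2), .jump (b + 3), .sub d x y]
  | seq c c', b => c.code b ++ c'.code (b + c.len)
  | loop k c, b => .jumpPos k (b + 2) :: .jump (b + (c.len + 3)) :: (c.code (b + 2) ++ [.jump b])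

theorem length_code (c : Cmd) (b : ℕ) : (c.code b).length = c.len := by
  induction c generalizing b <;> simp_all [code, len]

/-- The registers that a command may change. -/
def mods : Cmd → List ℕ
  | const d _ | add d _ _ | sub d _ _ | load d _ | subIf _ d _ _ => [d]
  | store _ _ => []
  | seq c c' => c.mods ++ c'.mods
  | loop _ c => c.mods

/-- `c.Exec B s t s'`: the command leads from the store `s` to `s'` in `t` steps, and all computed
numbers are smaller than `B` in absolute value. -/
inductive Exec (B : ℤ) : Cmd → Store → ℕ → Store → Prop
  | const {s : Store} {d : ℕ} {k : ℤ} (h : |k| < B) : Exec B (const d k) s 1 (s.setReg d k)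
  | add {s : Store} {d a b : ℕ} (h : |s.reg a + s.reg b| < B) :
      Exec B (add d a b) s 1 (s.setReg d (s.reg a + s.reg b))
  | sub {s : Store} {d a b : ℕ} (h : |s.reg a - s.reg b| < B) :
      Exec B (sub d a b) s 1 (s.setReg d (s.reg a - s.reg b))
  | load {s : Store} {d a : ℕ} (h : 0 ≤ s.reg a) :
      Exec B (load d a) s 1 (s.setReg d (s.mem (s.reg a).toNat))
  | store {s : Store} {a r : ℕ} (h : 0 ≤ s.reg a) :
      Exec B (store a r) s 1 (s.setMem (s.reg a).toNat (s.reg r))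
  | subIf_pos {s : Store} {g d a b : ℕ} (hg : 0 < s.reg g) (h : |s.reg a - s.reg b| < B) :
      Exec B (subIf g d a b) s 2 (s.setReg d (s.reg a - s.reg b))
  | subIf_neg {s : Store} {g d a b : ℕ} (hg : ¬ 0 < s.reg g) : Exec B (subIf g d a b) s 2 s
  | seq {s s' s'' : Store} {t t' : ℕ} {c c' : Cmd} (h : Exec B c s t s')
      (h' : Exec B c' s' t' s'') : Exec B (seq c c') s (t + t') s''
  | loop_exit {s : Store} {k : ℕ} {c : Cmd} (hk : ¬ 0 < s.reg k) : Exec B (loop k c) s 2 s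
  | loop_step {s s' s'' : Store} {t t' : ℕ} {k : ℕ} {c : Cmd} (hk : 0 < s.reg k)
      (h : Exec B c s t s') (h' : Exec B (loop k c) s' t' s'') :
      Exec B (loop k c) s (1 + (t + (1 + t'))) s''

variable {B : ℤ} {c : Cmd} {s s' : Store} {t : ℕ}

theorem Exec.agreeOff (h : c.Exec B s t s') : s.AgreeOff c.mods s' := by
  induction h with
  | seq _ _ ih ih' =>
    intro r hr
    rw [mods, List.mem_append, not_or] at hr
    rw [ih' r hr.2, ih r hr.1]
  | loop_step _ _ _ ih ih' => exact fun r hr => (ih' r hr).trans (ih r hr)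
  | store _ | subIf_neg _ | loop_exit _ => exact fun _ _ => rfl
  | _ => exact fun r hr => Function.update_of_ne (List.ne_of_not_mem_cons hr) _ _

theorem Exec.bounded (h : c.Exec B s t s') (hs : s.Bounded B) : s'.Bounded B := by
  induction h with
  | const h | add h | sub h | subIf_pos _ h => exact hs.setReg h
  | load _ => exact hs.setReg (hs.2 _)
  | store _ => exact hs.setMem (hs.1 _)
  | subIf_neg _ | loop_exit _ => exact hs
  | seq _ _ ih ih' | loop_step _ _ _ ih ih' => exact ih' (ih hs)

end Cmd

/-! ### Correctness of the compilation -/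

section Compilation

/-- The instructions `l` occur in `p` from number `b` on. -/
def HasCode (p : Program) (b : ℕ) (l : List Instr) : Prop :=
  ∃ x y, p = x ++ (l ++ y) ∧ x.length = b

/-- The program leads from `c` to `c'` in `t` steps, and all numbers on the way fit into `w`
bits. -/
def Reaches (p : Program) (w : ℕ) (c : Config) (t : ℕ) (c' : Config) : Prop :=
  run p c t = some c' ∧ ∀ s ≤ t, ∀ d, run p c s = some d → d.FitsIn w

variable {p : Program} {w b b' : ℕ} {l l' : List Instr} {i : Instr} {s s' : Store}

theorem HasCode.append_left (h : HasCode p b (l ++ l')) : HasCode p b l := by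
  obtain ⟨x, y, rfl, hx⟩ := h
  exact ⟨x, l' ++ y, by rw [List.append_assoc], hx⟩

theorem HasCode.append_right (h : HasCode p b (l ++ l')) : HasCode p (b + l.length) l' := by
  obtain ⟨x, y, rfl, rfl⟩ := h
  exact ⟨x ++ l, y, by simp only [List.append_assoc], List.length_append⟩

theorem HasCode.tail (h : HasCode p b (i :: l)) : HasCode p (b + 1) l :=
  h.append_right (l := [i])

theorem HasCode.getElem? (h : HasCode p b (i :: l)) : p[b]? = some i := by
  obtain ⟨x, y, rfl, rfl⟩ := h
  simp

theorem run_add (p : Program) (c : Config) (s t : ℕ) :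
    run p c (s + t) = (run p c s).bind (fun d => run p d t) := by
  induction t with
  | zero => simp [run]
  | succ t ih => rw [← add_assoc, run, ih, Option.bind_assoc]; rfl

theorem Reaches.trans {c d e : Config} {t t' : ℕ} (h : Reaches p w c t d)
    (h' : Reaches p w d t' e) : Reaches p w c (t + t') e := by
  refine ⟨by rw [run_add, h.1]; exact h'.1, fun r hr f hf => ?_⟩
  rcases le_total r t with hrt | hrt
  · exact h.2 r hrt f hf
  · obtain ⟨q, rfl⟩ := Nat.exists_eq_add_of_le hrt
    rw [run_add, h.1] at hf
    exact h'.2 q (by omega) f hf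

theorem Reaches.of_step (h : step p (s.withPC b) = some (s'.withPC b')) (hs : s.Bounded (2 ^ w))
    (hs' : s'.Bounded (2 ^ w)) : Reaches p w (s.withPC b) 1 (s'.withPC b') := by
  have h1 : run p (s.withPC b) 1 = some (s'.withPC b') := h
  refine ⟨h1, fun r hr f hf => ?_⟩
  rcases Nat.le_one_iff_eq_zero_or_eq_one.1 hr with rfl | rfl
  · exact Option.some.inj hf ▸ hs
  · exact Option.some.inj (h1 ▸ hf) ▸ hs'

theorem Reaches.jump (h : HasCode p b (.jump b' :: l)) (hs : s.Bounded (2 ^ w)) :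
    Reaches p w (s.withPC b) 1 (s.withPC b') :=
  .of_step (by simp [step, Store.withPC, h.getElem?]) hs hs

theorem Reaches.jumpPos_of_pos {r : ℕ} (h : HasCode p b (.jumpPos r b' :: l)) (hr : 0 < s.reg r)
    (hs : s.Bounded (2 ^ w)) : Reaches p w (s.withPC b) 1 (s.withPC b') :=
  .of_step (by simp [step, Store.withPC, h.getElem?, hr]) hs hs

theorem Reaches.jumpPos_of_not_pos {r l₁ : ℕ}
    (h : HasCode p b (.jumpPos r l₁ :: .jump b' :: l)) (hr : ¬ 0 < s.reg r)
    (hs : s.Bounded (2 ^ w)) : Reaches p w (s.withPC b) 2 (s.withPC b') :=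
  (Reaches.of_step (by simp [step, Store.withPC, h.getElem?, hr]) hs hs).trans (.jump h.tail hs)

theorem Cmd.Exec.reaches {c : Cmd} {t : ℕ} (h : c.Exec (2 ^ w) s t s') (hs : s.Bounded (2 ^ w)) :
    ∀ b, HasCode p b (c.code b) → Reaches p w (s.withPC b) t (s'.withPC (b + c.len)) := by
  induction h with
  | const h | add h | sub h =>
    intro b hb
    exact .of_step (by simp [step, Store.withPC, hb.getElem?, Store.setReg, len]) hs (hs.setReg h)
  | load h =>
    intro b hb
    exact .of_step (by simp [step, Store.withPC, hb.getElem?, Store.setReg, len, h]) hs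
      (hs.setReg (hs.2 _))
  | store h =>
    intro b hb
    exact .of_step (by simp [step, Store.withPC, hb.getElem?, Store.setMem, len, h]) hs
      (hs.setMem (hs.1 _))
  | subIf_pos hg h =>
    intro b hb
    exact (Reaches.jumpPos_of_pos hb hg hs).trans (t' := 1) <| .of_step
      (by simp [step, Store.withPC, hb.tail.tail.getElem?, Store.setReg, len]) hs (hs.setReg h)
  | subIf_neg hg => exact fun b hb => .jumpPos_of_not_pos hb hg hs
  | seq h _ ih ih' =>
    intro b hb
    have hb' := hb.append_right
    rw [length_code] at hb'
    rw [len, ← add_assoc]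
    exact (ih hs b hb.append_left).trans (ih' (h.bounded hs) _ hb')
  | loop_exit hk => exact fun b hb => .jumpPos_of_not_pos hb hk hs
  | loop_step hk h _ ih ih' =>
    intro b hb
    have hbody := hb.tail.tail
    have hback := hbody.append_right
    rw [length_code] at hback
    have hs' := h.bounded hs
    exact (Reaches.jumpPos_of_pos hb hk hs).trans <|
      (ih hs (b + 2) hbody.append_left).trans <| (Reaches.jump hback hs').trans (ih' hs' b hb)

end Compilation

/-! ### Hoare triples with running times -/

/-- Started in a store with property `P`, the command ends after at most `T` steps in a store with
property `Q`, and all numbers that it computes are smaller than `B` in absolute value. -/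
def Triple (B : ℤ) (P : Store → Prop) (c : Cmd) (T : ℕ) (Q : Store → Prop) : Prop :=
  ∀ s, P s → ∃ t ≤ T, ∃ s', c.Exec B s t s' ∧ Q s'

/-- The weakest precondition of a command without loops. -/
def Cmd.wp (B : ℤ) : Cmd → (Store → Prop) → Store → Prop
  | const d k, Q, s => |k| < B ∧ Q (s.setReg d k)
  | add d a b, Q, s => |s.reg a + s.reg b| < B ∧ Q (s.setReg d (s.reg a + s.reg b))
  | sub d a b, Q, s => |s.reg a - s.reg b| < B ∧ Q (s.setReg d (s.reg a - s.reg b))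
  | load d a, Q, s => 0 ≤ s.reg a ∧ Q (s.setReg d (s.mem (s.reg a).toNat))
  | store a r, Q, s => 0 ≤ s.reg a ∧ Q (s.setMem (s.reg a).toNat (s.reg r))
  | subIf g d a b, Q, s => (0 < s.reg g → |s.reg a - s.reg b| < B) ∧
      Q (s.setReg d (if 0 < s.reg g then s.reg a - s.reg b else s.reg d))
  | seq c c', Q, s => c.wp B (c'.wp B Q) s
  | loop _ _, _, _ => False

namespace Triple

variable {B : ℤ} {P P' Q Q' R : Store → Prop} {c c' : Cmd} {T T' : ℕ}

theorem mono (h : Triple B P c T Q) (hP : ∀ s, P' s → P s) (hT : T ≤ T') (hQ : ∀ s, Q s → Q' s) :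
    Triple B P' c T' Q' := by
  intro s hs
  obtain ⟨t, ht, s', he, hs'⟩ := h s (hP s hs)
  exact ⟨t, ht.trans hT, s', he, hQ s' hs'⟩

theorem seq (h : Triple B P c T R) (h' : Triple B R c' T' Q) :
    Triple B P (c ;; c') (T + T') Q := by
  intro s hs
  obtain ⟨t, ht, s', he, hs'⟩ := h s hs
  obtain ⟨t', ht', s'', he', hs''⟩ := h' s' hs'
  exact ⟨t + t', add_le_add ht ht', s'', .seq he he', hs''⟩

theorem of_wp (h : ∀ s, P s → c.wp B Q s) : Triple B P c c.len Q := by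
  induction c generalizing P Q with
  | const d k => exact fun s hs => ⟨1, le_rfl, _, .const (h s hs).1, (h s hs).2⟩
  | add d a b => exact fun s hs => ⟨1, le_rfl, _, .add (h s hs).1, (h s hs).2⟩
  | sub d a b => exact fun s hs => ⟨1, le_rfl, _, .sub (h s hs).1, (h s hs).2⟩
  | load d a => exact fun s hs => ⟨1, le_rfl, _, .load (h s hs).1, (h s hs).2⟩
  | store a r => exact fun s hs => ⟨1, le_rfl, _, .store (h s hs).1, (h s hs).2⟩
  | subIf g d a b =>
    intro s hs
    obtain ⟨hlt, hq⟩ := h s hs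
    by_cases hg : 0 < s.reg g
    · exact ⟨2, Nat.le_succ 2, _, .subIf_pos hg (hlt hg), by simpa only [if_pos hg] using hq⟩
    · refine ⟨2, Nat.le_succ 2, _, .subIf_neg hg, ?_⟩
      simpa only [if_neg hg, Store.setReg, Function.update_eq_self] using hq
  | seq c c' ih ih' => exact (ih h).seq (ih' fun _ hs => hs)
  | loop k c => exact fun s hs => (h s hs).elim

theorem frame (h : Triple B P c T Q) (hR : ∀ s s', s.AgreeOff c.mods s' → R s → R s') :
    Triple B (fun s => R s ∧ P s) c T (fun s => R s ∧ Q s) := by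
  intro s hs
  obtain ⟨t, ht, s', he, hs'⟩ := h s hs.2
  exact ⟨t, ht, s', he, hR s s' he.agreeOff hs.1, hs'⟩

theorem loop {k N : ℕ} {I : ℕ → Store → Prop}
    (h : ∀ i < N, Triple B (fun s => s.reg k = N - i ∧ I i s) c T
      (fun s => s.reg k = N - i - 1 ∧ I (i + 1) s)) :
    Triple B (fun s => s.reg k = N ∧ I 0 s) (.loop k c) (N * (T + 2) + 2) (I N) := by
  suffices ∀ l i, i + l = N →
      Triple B (fun s => s.reg k = l ∧ I i s) (.loop k c) (l * (T + 2) + 2) (I N) from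
    this N 0 (zero_add N)
  intro l
  induction l with
  | zero =>
    rintro i rfl s ⟨hk, hs⟩
    exact ⟨2, by omega, s, .loop_exit (by simp [hk]), hs⟩
  | succ l ih =>
    rintro i hi s ⟨hk, hs⟩
    obtain ⟨t, ht, s', he, hk', hs'⟩ := h i (by omega) s ⟨by omega, hs⟩
    obtain ⟨t', ht', s'', he', hs''⟩ := ih (i + 1) (by omega) s' ⟨by omega, hs'⟩
    refine ⟨1 + (t + (1 + t')), ?_, s'', .loop_step (by omega) he he', hs''⟩
    rw [Nat.succ_mul]
    omega

end Triple

/-! ### Registers -/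

section Machine

local notation "rM" => 0
local notation "rN" => 1
local notation "rZero" => 2
local notation "rOne" => 3
local notation "rSize" => 4
local notation "rOffsets" => 5
local notation "rBuffer" => 6
local notation "rRound" => 7
local notation "rRow" => 8
local notation "rCol" => 9
local notation "pUpper" => 10
local notation "pBase" => 11
local notation "pSums" => 12
local notation "pOffset" => 13
local notation "pBuffer" => 14
local notation "rRowSign" => 15
local notation "rSign" => 16
local notation "rPair" => 17
local notation "rMin" => 18
local notation "rOk" => 19
local notation "rX" => 20
local notation "rY" => 21
local notation "rZ" => 22
local notation "rEntry" => 23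
local notation "pEntry" => 24

open Cmd

/-- The command that executes `c` as often as register `b` says, with `k` as the counter. -/
def times (k b : ℕ) (c : Cmd) : Cmd := add k b rZero ;; loop k (c ;; sub k k rOne)

theorem Triple.times {B : ℤ} {k b N T : ℕ} {c : Cmd} {I : ℕ → Store → Prop}
    (hconst : ∀ i s, I i s → s.reg rZero = 0 ∧ s.reg rOne = 1 ∧ s.reg b = N)
    (hset : ∀ i s v, I i s → I i (s.setReg k v)) (hk : k ∉ c.mods) (hN : N < B)
    (h : ∀ i < N, Triple B (I i) c T (I (i + 1))) :
    Triple B (I 0) (times k b c) (N * (T + 3) + 3) (I N) := by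
  have hinit : Triple B (I 0) (add k b rZero) 1 (fun s => s.reg k = N ∧ I 0 s) := by
    refine .of_wp fun s hs => ?_
    obtain ⟨h0, -, hb⟩ := hconst 0 s hs
    refine ⟨?_, ?_, hset _ _ _ hs⟩ <;> simp [Store.setReg, hb, h0, hN]
  refine (hinit.seq (.loop (T := T + 1) fun i hi => ?_)).mono (fun _ => id) (by linarith)
    fun _ => id
  have hbody := (h i hi).frame (R := fun s => s.reg k = N - i) fun s s' hs hR => (hs k hk).trans hR
  refine hbody.seq (.of_wp fun s ⟨hks, hs⟩ => ?_)
  obtain ⟨-, h1, -⟩ := hconst _ s hs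
  refine ⟨?_, ?_, hset _ _ _ hs⟩ <;>
    simp only [Store.setReg, Function.update_self, hks, h1]
  rw [abs_lt]
  omega

/-- The contents of the registers that remain constant during the main part of the program: memory
cells `0, …, 4mn - 1` are divided into the upper bounds, to be replaced by the result, the window
sums, the base matrix, the `n` column offsets from address `3mn` on, and a buffer for a row of the
particular solution from address `3mn + n` on. -/
structure Layout (m n : ℕ) (s : Store) : Prop where
  rows : s.reg rM = m
  cols : s.reg rN = n
  zero : s.reg rZero = 0
  one : s.reg rOne = 1
  size : s.reg rSize = (m * n : ℕ)
  offsets : s.reg rOffsets = (3 * (m * n) : ℕ)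
  buffer : s.reg rBuffer = (3 * (m * n) + n : ℕ)

theorem Layout.of_agreeOff {m n : ℕ} {s s' : Store} {l : List ℕ} (h : Layout m n s)
    (hl : ∀ r ∈ l, rRound ≤ r) (hs : s.AgreeOff l s') : Layout m n s' := by
  have hreg : ∀ r < rRound, s'.reg r = s.reg r := fun r hr => hs r fun hmem => hr.not_ge (hl r hmem)
  obtain ⟨h0, h1, h2, h3, h4, h5, h6⟩ := h
  constructor <;> rw [hreg _ (by decide)] <;> assumption

/-- A triple for a command in the main part of the program. -/
def LayoutTriple (m n : ℕ) (B : ℤ) (P : Store → Prop) (c : Cmd) (T : ℕ) (Q : Store → Prop) :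
    Prop :=
  Triple B (fun s => Layout m n s ∧ P s) c T (fun s => Layout m n s ∧ Q s)

namespace LayoutTriple

variable {m n T T' : ℕ} {B : ℤ} {P P' Q Q' R : Store → Prop} {c c' : Cmd}

theorem mono (h : LayoutTriple m n B P c T Q) (hP : ∀ s, P' s → P s) (hT : T ≤ T')
    (hQ : ∀ s, Q s → Q' s) : LayoutTriple m n B P' c T' Q' :=
  Triple.mono h (fun s => .imp_right (hP s)) hT fun s => .imp_right (hQ s)

theorem seq (h : LayoutTriple m n B P c T R) (h' : LayoutTriple m n B R c' T' Q) :
    LayoutTriple m n B P (c ;; c') (T + T') Q :=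
  Triple.seq h h'

theorem of_wp (hc : ∀ r ∈ c.mods, rRound ≤ r) (h : ∀ s, Layout m n s → P s → c.wp B Q s) :
    LayoutTriple m n B P c c.len Q :=
  ((Triple.of_wp fun s (hs : Layout m n s ∧ P s) => h s hs.1 hs.2).frame
    fun _ _ hs hlayout => hlayout.of_agreeOff hc hs).mono (fun _ hs => ⟨hs.1, hs⟩) le_rfl
    fun _ => id

theorem frame (h : LayoutTriple m n B P c T Q) (hR : ∀ s s', s.AgreeOff c.mods s' → R s → R s') :
    LayoutTriple m n B (fun s => R s ∧ P s) c T (fun s => R s ∧ Q s) :=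
  (Triple.frame h hR).mono (fun _ => and_left_comm.1) le_rfl fun _ => and_left_comm.1

theorem times {k b N : ℕ} {I : ℕ → Store → Prop} (hb : ∀ s, Layout m n s → s.reg b = N)
    (hk : rRound ≤ k) (hset : ∀ i s v, I i s → I i (s.setReg k v)) (hkc : k ∉ c.mods) (hN : N < B)
    (h : ∀ i < N, LayoutTriple m n B (I i) c T (I (i + 1))) :
    LayoutTriple m n B (I 0) (times k b c) (N * (T + 3) + 3) (I N) := by
  refine Triple.times (I := fun i s => Layout m n s ∧ I i s)
    (fun i s hs => ⟨hs.1.zero, hs.1.one, hb s hs.1⟩)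
    (fun i s v hs => ⟨hs.1.of_agreeOff (l := [k]) (by simpa using hk) fun r hr => ?_,
      hset i s v hs.2⟩) hkc hN h
  exact Function.update_of_ne (List.ne_of_not_mem_cons hr) _ _

end LayoutTriple

/-! ### Contents of the memory -/

section Memory

/-- The `L` memory cells from address `a` on contain the first `L` values of `c`. -/
def HoldsAt (mem : ℕ → ℤ) (a L : ℕ) (c : ℕ → ℤ) : Prop := ∀ k < L, mem (a + k) = c k

/-- The entries of a matrix with `n` columns, row by row. -/
def rowMajor (n : ℕ) (f : ℕ → ℕ → ℤ) (x : ℕ) : ℤ := f (x / n) (x % n)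

/-- The sequence `c` with its first `l` entries replaced by those of `c'`. -/
def splice (c c' : ℕ → ℤ) (l k : ℕ) : ℤ := if k < l then c' k else c k

/-- The division of the memory described at `Layout`, with `a` in the place of the upper bounds,
base matrix `v`, column offsets `c` and buffer `w`. -/
structure Arrays (m n : ℕ) (S : ℕ → ℕ → ℤ) (a v c w mem : ℕ → ℤ) : Prop where
  upper : HoldsAt mem 0 (m * n) a
  sums : ∀ i < m, ∀ j < n, mem (m * n + (i * (n - 1) + j)) = S i j
  base : HoldsAt mem (2 * (m * n)) (m * n) v
  offsets : HoldsAt mem (3 * (m * n)) n c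
  buffer : HoldsAt mem (3 * (m * n) + n) n w

variable {m n i j l L b : ℕ} {S : ℕ → ℕ → ℤ} {a c c' v w mem : ℕ → ℤ} {z : ℤ}

theorem rowMajor_apply (f : ℕ → ℕ → ℤ) (i : ℕ) (hj : j < n) : rowMajor n f (i * n + j) = f i j := by
  rw [rowMajor, mul_comm, Nat.mul_add_div (by omega), Nat.div_eq_of_lt hj, add_zero,
    Nat.mul_add_mod, Nat.mod_eq_of_lt hj]

theorem mul_add_lt (hi : i < m) (hj : j < n) : i * n + j < m * n :=
  calc i * n + j < i * n + n := by omega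
    _ = (i + 1) * n := by ring
    _ ≤ m * n := Nat.mul_le_mul_right n hi

theorem splice_zero (c c' : ℕ → ℤ) : splice c c' 0 = c := by
  funext k
  rw [splice, if_neg k.not_lt_zero]

theorem splice_of_le (h : l ≤ i) : splice c c' l i = c i := if_neg h.not_gt

theorem update_splice (c c' : ℕ → ℤ) (l : ℕ) :
    Function.update (splice c c' l) l (c' l) = splice c c' (l + 1) := by
  funext k
  simp only [Function.update_apply, splice]
  split_ifs with h <;> first | omega | rw [h]

theorem HoldsAt.of_splice (h : HoldsAt mem b L (splice c c' L)) : HoldsAt mem b L c' :=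
  fun k hk => (h k hk).trans (if_pos hk)

theorem HoldsAt.update (h : HoldsAt mem b L c) (l : ℕ) (z : ℤ) :
    HoldsAt (Function.update mem (b + l) z) b L (Function.update c l z) := by
  intro k hk
  simp only [Function.update_apply, Nat.add_left_cancel_iff, h k hk]

theorem HoldsAt.update_of_disjoint {a : ℕ} (h : HoldsAt mem b L c) (z : ℤ)
    (ha : a < b ∨ b + L ≤ a) : HoldsAt (Function.update mem a z) b L c := by
  intro k hk
  rw [Function.update_of_ne (by omega), h k hk]

namespace Arrays

theorem sums_lt (hi : i < m) (hj : j < n) : i * (n - 1) + j < m * n :=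
  (add_le_add_left (Nat.mul_le_mul_left i (Nat.sub_le n 1)) j).trans_lt (mul_add_lt hi hj)

theorem update_upper (h : Arrays m n S a v c w mem) (hl : l < m * n) (z : ℤ) :
    Arrays m n S (Function.update a l z) v c w (Function.update mem l z) where
  upper := by simpa only [zero_add] using h.upper.update l z
  sums i hi j hj := by rw [Function.update_of_ne (by omega), h.sums i hi j hj]
  base := h.base.update_of_disjoint z (by omega)
  offsets := h.offsets.update_of_disjoint z (by omega)
  buffer := h.buffer.update_of_disjoint z (by omega)

theorem update_base (h : Arrays m n S a v c w mem) (hl : l < m * n) (z : ℤ) :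
    Arrays m n S a (Function.update v l z) c w (Function.update mem (2 * (m * n) + l) z) where
  upper := h.upper.update_of_disjoint z (by omega)
  sums i hi j hj := by
    rw [Function.update_of_ne (by have := sums_lt hi hj; omega), h.sums i hi j hj]
  base := h.base.update l z
  offsets := h.offsets.update_of_disjoint z (by omega)
  buffer := h.buffer.update_of_disjoint z (by omega)

theorem update_offsets (h : Arrays m n S a v c w mem) (hl : l < n) (z : ℤ) :
    Arrays m n S a v (Function.update c l z) w (Function.update mem (3 * (m * n) + l) z) where
  upper := h.upper.update_of_disjoint z (by omega)
  sums i hi j hj := by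
    rw [Function.update_of_ne (by have := sums_lt hi hj; omega), h.sums i hi j hj]
  base := h.base.update_of_disjoint z (by omega)
  offsets := h.offsets.update l z
  buffer := h.buffer.update_of_disjoint z (by omega)

theorem update_buffer (h : Arrays m n S a v c w mem) (l : ℕ) (z : ℤ) :
    Arrays m n S a v c (Function.update w l z)
      (Function.update mem (3 * (m * n) + n + l) z) where
  upper := h.upper.update_of_disjoint z (by omega)
  sums i hi j hj := by
    rw [Function.update_of_ne (by have := sums_lt hi hj; omega), h.sums i hi j hj]
  base := h.base.update_of_disjoint z (by omega)
  offsets := h.offsets.update_of_disjoint z (by omega)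
  buffer := h.buffer.update l z

end Arrays

end Memory

/-! ### The program -/

/-- Computes an entry of the base matrix and an entry of the next row of the particular solution. -/
def fillStep : Cmd :=
  load rX pBuffer ;; load rY pUpper ;; load rZ pSums ;;
  add rEntry rX rZero ;; subIf rSign rEntry rY rX ;; store pBase rEntry ;;
  sub rX rPair rX ;; store pBuffer rX ;; sub rPair rZ rPair ;;
  add pUpper pUpper rOne ;; add pBase pBase rOne ;; add pSums pSums rOne ;;
  add pBuffer pBuffer rOne ;; sub rSign rZero rSign

/-- Computes a row of the base matrix from a row of the particular solution, which is replaced by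
the next one. -/
def fillRow : Cmd :=
  (add rSign rRowSign rZero ;; sub rRowSign rZero rRowSign ;; const rPair 0 ;;
    add pBuffer rBuffer rZero) ;;
  times rCol rN fillStep ;;
  sub pSums pSums rOne

/-- Computes the base matrix. -/
def fill : Cmd :=
  (const pUpper 0 ;; add pBase rSize rSize ;; add pSums rSize rZero ;; const rRowSign 1) ;;
  times rRow rM fillRow

/-- Takes one more entry into account in the computation of a minimum of a row. -/
def minStep : Cmd :=
  load rX pEntry ;; load rY pOffset ;; add rX rX rY ;; sub rY rMin rX ;;
  subIf rY rMin rX rZero ;;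
  add pEntry pEntry rOne ;; add pOffset pOffset rOne

/-- Computes the minimum of the row of the base matrix at address `pBase`, shifted by the column
offsets. -/
def minRow : Cmd :=
  (add pEntry pBase rZero ;; add pOffset rOffsets rZero ;;
    load rX pEntry ;; load rY pOffset ;; add rMin rX rY) ;;
  times rCol rN minStep

/-- Relaxes a column offset with respect to one row. -/
def relaxStep : Cmd :=
  load rX pBase ;; load rY pUpper ;; load rZ pOffset ;;
  sub rX rMin rX ;; add rX rX rY ;; sub rY rZ rX ;; subIf rY rZ rX rZero ;; store pOffset rZ ;;
  add pUpper pUpper rOne ;; add pBase pBase rOne ;; add pOffset pOffset rOne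

/-- Relaxes the column offsets with respect to one row. -/
def relaxLine : Cmd :=
  minRow ;; add pOffset rOffsets rZero ;; times rCol rN relaxStep

/-- One round of the relaxation. -/
def relaxRound : Cmd :=
  (const pUpper 0 ;; add pBase rSize rSize) ;; times rRow rM relaxLine

/-- The relaxation of the column offsets. -/
def relax : Cmd := times rRound rN relaxRound

/-- Replaces an upper bound by an entry of the candidate and clears the flag `rOk` if the bound is
violated. -/
def outStep : Cmd :=
  load rX pBase ;; load rY pOffset ;; load rZ pUpper ;;
  add rX rX rY ;; sub rX rX rMin ;; sub rY rX rZ ;; subIf rY rOk rZero rZero ;;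
  subIf rSign rX rZ rX ;; store pUpper rX ;;
  add pUpper pUpper rOne ;; add pBase pBase rOne ;; add pOffset pOffset rOne ;;
  sub rSign rZero rSign

/-- Replaces a row of upper bounds by a row of the candidate. -/
def outRow : Cmd :=
  (minRow ;;
    (add rSign rRowSign rZero ;; sub rRowSign rZero rRowSign ;; add pOffset rOffsets rZero)) ;;
  times rCol rN outStep

/-- Replaces the upper bounds by the candidate. -/
def out : Cmd :=
  (const pUpper 0 ;; add pBase rSize rSize ;; const rRowSign 1 ;; const rOk 1) ;;
  times rRow rM outRow

/-- Computes the addresses described at `Layout`. -/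
def setup : Cmd :=
  const rOne 1 ;; times rRow rM (add rSize rSize rN) ;;
  (add rOffsets rSize rSize ;; add rOffsets rOffsets rSize ;; add rBuffer rOffsets rN)

/-- The whole program except for the final `halt`. -/
def main : Cmd := setup ;; (fill ;; relax ;; out) ;; add rM rOk rZero

/-! ### Correctness of the program -/

section Correctness

/-- `H` bounds the addresses and the numbers that occur in the course of the program. -/
structure Small (m n : ℕ) (U S : ℕ → ℕ → ℤ) (H : ℤ) : Prop where
  size : (8 * (m * n) : ℕ) ≤ H
  upper : ∀ i < m, ∀ j < n, |U i j| ≤ H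
  sums : ∀ i < m, ∀ j < n, |S i j| ≤ H
  pairSum : ∀ i < m, ∀ j < n, |pairSum S i j| ≤ H
  particular : ∀ i < m, ∀ j < n, |particular S i j| ≤ H
  base : ∀ i < m, ∀ j < n, |base U S i j| ≤ H
  offsets : ∀ t ≤ n, ∀ i ≤ m, ∀ j < n,
    |relaxRows n (WindowSums.base U S) U (WindowSums.offsets m n (WindowSums.base U S) U t) i j| ≤ H

variable {m n : ℕ} {U S : ℕ → ℕ → ℤ} {B H : ℤ}

theorem neg_one_pow_pos_iff (k : ℕ) : 0 < (-1 : ℤ) ^ k ↔ Even k := by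
  rcases k.even_or_odd with h | h
  · simp [h.neg_one_pow, h]
  · simp [h.neg_one_pow, Nat.not_even_iff_odd.2 h]

/-- The state of the first phase before the computation of the entry `(i, j)`. -/
structure FillState (m n : ℕ) (U S : ℕ → ℕ → ℤ) (i j : ℕ) (s : Store) : Prop where
  arrays : Arrays m n S (rowMajor n U) (splice 0 (rowMajor n (base U S)) (i * n + j)) 0
    (splice (particular S i) (particular S (i + 1)) j) s.mem
  upper_eq : s.reg pUpper = (i * n + j : ℕ)
  base_eq : s.reg pBase = (2 * (m * n) + (i * n + j) : ℕ)
  sums_eq : s.reg pSums = (m * n + (i * (n - 1) + j) : ℕ)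
  buffer_eq : s.reg pBuffer = (3 * (m * n) + n + j : ℕ)
  rowSign_eq : s.reg rRowSign = (-1) ^ (i + 1)
  sign_eq : s.reg rSign = (-1) ^ (i + j)
  pair_eq : s.reg rPair = pairSum S i j

theorem fillStep_spec (h : Small m n U S H) (hB : 8 * H < B) {i j : ℕ} (hi : i < m) (hj : j < n) :
    LayoutTriple m n B (FillState m n U S i j) fillStep 16 (FillState m n U S i (j + 1)) := by
  refine .of_wp (by decide) fun s hl hs => ?_
  have hlt := mul_add_lt hi hj
  have hU : s.mem (i * n + j) = U i j := by
    simpa only [zero_add, rowMajor_apply _ _ hj] using hs.arrays.upper _ hlt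
  have hw : s.mem (3 * (m * n) + n + j) = particular S i j :=
    (hs.arrays.buffer j hj).trans (splice_of_le le_rfl)
  have hS := hs.arrays.sums i hi j hj
  simp only [fillStep, wp, Store.setReg, Store.setMem, Function.update_apply, Nat.reduceEqDiff,
    if_true, if_false, hs.upper_eq, hs.base_eq, hs.sums_eq, hs.buffer_eq, hs.sign_eq, hs.pair_eq,
    Int.toNat_natCast, hU, hw, hS, hl.zero, hl.one, add_zero, neg_one_pow_pos_iff, abs_lt]
  have hmem := (hs.arrays.update_base hlt (rowMajor n (base U S) (i * n + j))).update_buffer j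
    (particular S (i + 1) j)
  rw [update_splice, update_splice, rowMajor_apply _ _ hj] at hmem
  have hU := abs_le.1 (h.upper i hi j hj)
  have hS := abs_le.1 (h.sums i hi j hj)
  have hw := abs_le.1 (h.particular i hi j hj)
  have hp := abs_le.1 (h.pairSum i hi j hj)
  have hH := h.size
  have hsign := neg_one_pow_eq_or ℤ (i + j)
  have := Arrays.sums_lt hi hj
  have := Nat.le_mul_of_pos_left n (Nat.zero_lt_of_lt hi)
  repeat refine ⟨by intros; omega, ?_⟩
  exact {
    arrays := hmem
    upper_eq := (Nat.cast_succ _).symm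
    base_eq := (Nat.cast_succ _).symm
    sums_eq := (Nat.cast_succ _).symm
    buffer_eq := (Nat.cast_succ _).symm
    rowSign_eq := hs.rowSign_eq
    sign_eq := (zero_sub _).trans (by ring)
    pair_eq := rfl }

/-- The state of the first phase before row `i`. -/
structure FillRowState (m n : ℕ) (U S : ℕ → ℕ → ℤ) (i : ℕ) (s : Store) : Prop where
  arrays : Arrays m n S (rowMajor n U) (splice 0 (rowMajor n (base U S)) (i * n)) 0
    (particular S i) s.mem
  upper_eq : s.reg pUpper = (i * n : ℕ)
  base_eq : s.reg pBase = (2 * (m * n) + i * n : ℕ)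
  sums_eq : s.reg pSums = (m * n + i * (n - 1) : ℕ)
  rowSign_eq : s.reg rRowSign = (-1) ^ i

theorem fillRow_spec (h : Small m n U S H) (hB : 8 * H < B) {i : ℕ} (hi : i < m) (hn : 0 < n) :
    LayoutTriple m n B (FillRowState m n U S i) fillRow (n * 19 + 8)
      (FillRowState m n U S (i + 1)) := by
  have hle := Nat.le_mul_of_pos_left n (Nat.zero_lt_of_lt hi)
  have hH := h.size
  have hsign := neg_one_pow_eq_or ℤ i
  have henter : LayoutTriple m n B (FillRowState m n U S i)
      (add rSign rRowSign rZero ;; sub rRowSign rZero rRowSign ;; const rPair 0 ;;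
        add pBuffer rBuffer rZero) 4 (FillState m n U S i 0) := by
    refine .of_wp (by decide) fun s hl hs => ?_
    simp only [wp, Store.setReg, Function.update_apply, Nat.reduceEqDiff, if_false,
      hs.rowSign_eq, hl.zero, hl.buffer, add_zero, abs_lt]
    repeat refine ⟨by omega, ?_⟩
    exact {
      arrays := by simpa only [add_zero, splice_zero] using hs.arrays
      upper_eq := hs.upper_eq
      base_eq := hs.base_eq
      sums_eq := hs.sums_eq
      buffer_eq := rfl
      rowSign_eq := (zero_sub _).trans (by ring)
      sign_eq := rfl
      pair_eq := rfl }
  have hloop := LayoutTriple.times (k := rCol) (I := FillState m n U S i) (fun _ hl => hl.cols)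
    (by decide) (fun _ _ _ ⟨h1, h2, h3, h4, h5, h6, h7, h8⟩ => ⟨h1, h2, h3, h4, h5, h6, h7, h8⟩)
    (by decide) (by omega) fun j hj => fillStep_spec h hB hi hj
  have hexit : LayoutTriple m n B (FillState m n U S i n) (sub pSums pSums rOne) 1
      (FillRowState m n U S (i + 1)) := by
    refine .of_wp (by decide) fun s hl hs => ?_
    obtain ⟨⟨h1, h2, h3, h4, h5⟩, hupper, hbase, hsums, -, hsign, -, -⟩ := hs
    simp only [wp, Store.setReg, hsums, hl.one, abs_lt]
    rw [← Nat.succ_mul] at h3 hupper hbase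
    have := Arrays.sums_lt hi (Nat.sub_one_lt_of_lt hn)
    refine ⟨by omega, ⟨h1, h2, h3, h4, h5.of_splice⟩, hupper, hbase, ?_, hsign⟩
    simp only [Function.update_self, Nat.succ_mul]
    omega
  exact (henter.seq (hloop.seq hexit)).mono (fun _ => id) (by omega) fun _ => id

theorem fill_spec (h : Small m n U S H) (hB : 8 * H < B) (hm : 0 < m) (hn : 0 < n) :
    LayoutTriple m n B (fun s => Arrays m n S (rowMajor n U) 0 0 0 s.mem) fill
      (m * (n * 19 + 11) + 7)
      (fun s => Arrays m n S (rowMajor n U) (rowMajor n (base U S)) 0 (particular S m) s.mem) := by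
  have hle := Nat.le_mul_of_pos_right m hn
  have hH := h.size
  have henter : LayoutTriple m n B (fun s => Arrays m n S (rowMajor n U) 0 0 0 s.mem)
      (const pUpper 0 ;; add pBase rSize rSize ;; add pSums rSize rZero ;; const rRowSign 1) 4
      (FillRowState m n U S 0) := by
    refine .of_wp (by decide) fun s hl hs => ?_
    simp only [wp, Store.setReg, Function.update_apply, Nat.reduceEqDiff, if_false, hl.zero,
      hl.size, abs_lt]
    repeat refine ⟨by omega, ?_⟩
    exact {
      arrays := by
        rw [zero_mul, splice_zero]
        exact hs
      upper_eq := by simp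
      base_eq := by
        simp only [Function.update_apply, Nat.reduceEqDiff, if_true, if_false]
        omega
      sums_eq := by simp
      rowSign_eq := rfl }
  have hloop := LayoutTriple.times (k := rRow) (I := FillRowState m n U S) (fun _ hl => hl.rows)
    (by decide) (fun _ _ _ ⟨h1, h2, h3, h4, h5⟩ => ⟨h1, h2, h3, h4, h5⟩) (by decide) (by omega)
    fun i hi => fillRow_spec h hB hi hn
  refine (henter.seq hloop).mono (fun _ => id) (by linarith) fun s hs => ?_
  exact { hs.arrays with base := hs.arrays.base.of_splice }

/-- The state of `minRow` before the consideration of entry `j` of row `i`. -/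
structure MinState (m n : ℕ) (S u : ℕ → ℕ → ℤ) (a c w : ℕ → ℤ) (i j : ℕ) (s : Store) :
    Prop where
  arrays : Arrays m n S a (rowMajor n u) c w s.mem
  entry_eq : s.reg pEntry = (2 * (m * n) + (i * n + j) : ℕ)
  offset_eq : s.reg pOffset = (3 * (m * n) + j : ℕ)
  min_eq : s.reg rMin = rowMin u c i j

variable {u : ℕ → ℕ → ℤ} {a c w : ℕ → ℤ} {i j : ℕ}

theorem minStep_spec (hH : (8 * (m * n) : ℕ) ≤ H) (hB : 8 * H < B) (hu : ∀ j < n, |u i j| ≤ H)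
    (hc : ∀ j < n, |c j| ≤ H) (hi : i < m) (hj : j < n) :
    LayoutTriple m n B (MinState m n S u a c w i j) minStep 9
      (MinState m n S u a c w i (j + 1)) := by
  refine .of_wp (by decide) fun s hl hs => ?_
  have hlt := mul_add_lt hi hj
  have hu' : s.mem (2 * (m * n) + (i * n + j)) = u i j :=
    (hs.arrays.base _ hlt).trans (rowMajor_apply _ _ hj)
  simp only [minStep, wp, Store.setReg, Function.update_apply, Nat.reduceEqDiff,
    if_true, if_false, hs.entry_eq, hs.offset_eq, hs.min_eq, Int.toNat_natCast, hu',
    hs.arrays.offsets j hj, hl.zero, hl.one, sub_zero, abs_lt]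
  have hmin := abs_le.1 (abs_rowMin_le (k := j) hj.le (by omega) hu hc)
  have hu := abs_le.1 (hu j hj)
  have hc := abs_le.1 (hc j hj)
  have := Nat.le_mul_of_pos_left n (Nat.zero_lt_of_lt hi)
  repeat refine ⟨by intros; omega, ?_⟩
  exact {
    arrays := hs.arrays
    entry_eq := (Nat.cast_succ _).symm
    offset_eq := (Nat.cast_succ _).symm
    min_eq := by
      simp only [Function.update_apply, Nat.reduceEqDiff, if_true, if_false, rowMin]
      omega }

theorem minRow_spec (hH : (8 * (m * n) : ℕ) ≤ H) (hB : 8 * H < B) (hu : ∀ j < n, |u i j| ≤ H)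
    (hc : ∀ j < n, |c j| ≤ H) (hi : i < m) (hn : 0 < n) :
    LayoutTriple m n B
      (fun s => Arrays m n S a (rowMajor n u) c w s.mem ∧ s.reg pBase = (2 * (m * n) + i * n : ℕ))
      minRow (n * 12 + 8)
      (fun s => Arrays m n S a (rowMajor n u) c w s.mem ∧ s.reg rMin = rowMin u c i n) := by
  have hle := Nat.le_mul_of_pos_left n (Nat.zero_lt_of_lt hi)
  have henter : LayoutTriple m n B
      (fun s => Arrays m n S a (rowMajor n u) c w s.mem ∧ s.reg pBase = (2 * (m * n) + i * n : ℕ))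
      (add pEntry pBase rZero ;; add pOffset rOffsets rZero ;;
        load rX pEntry ;; load rY pOffset ;; add rMin rX rY) 5 (MinState m n S u a c w i 0) := by
    refine .of_wp (by decide) fun s hl ⟨hs, hbase⟩ => ?_
    have hlt := mul_add_lt hi hn
    have hu' : s.mem (2 * (m * n) + i * n) = u i 0 :=
      (hs.base _ hlt).trans (rowMajor_apply _ _ hn)
    have hc' : s.mem (3 * (m * n)) = c 0 := hs.offsets 0 hn
    simp only [wp, Store.setReg, Function.update_apply, Nat.reduceEqDiff,
      if_true, if_false, hbase, hl.zero, hl.offsets, add_zero, Int.toNat_natCast, hu', hc', abs_lt]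
    have hu := abs_le.1 (hu 0 hn)
    have hc := abs_le.1 (hc 0 hn)
    repeat refine ⟨by omega, ?_⟩
    exact ⟨hs, rfl, rfl, rfl⟩
  have hloop := LayoutTriple.times (k := rCol) (I := MinState m n S u a c w i)
    (fun _ hl => hl.cols) (by decide) (fun _ _ _ ⟨h1, h2, h3, h4⟩ => ⟨h1, h2, h3, h4⟩) (by decide)
    (by omega) fun j hj => minStep_spec hH hB hu hc hi hj
  exact (henter.seq hloop).mono (fun _ => id) (by omega) fun s hs => ⟨hs.arrays, hs.min_eq⟩

/-- The state during the relaxation with respect to row `i` before the treatment of offset `j`. -/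
structure RelaxState (m n : ℕ) (U S : ℕ → ℕ → ℤ) (c w : ℕ → ℤ) (i j : ℕ) (s : Store) : Prop where
  arrays : Arrays m n S (rowMajor n U) (rowMajor n (base U S))
    (splice c (relaxRow n (base U S) U i c) j) w s.mem
  upper_eq : s.reg pUpper = (i * n + j : ℕ)
  base_eq : s.reg pBase = (2 * (m * n) + (i * n + j) : ℕ)
  offset_eq : s.reg pOffset = (3 * (m * n) + j : ℕ)
  min_eq : s.reg rMin = rowMin (base U S) c i n

theorem relaxStep_spec (h : Small m n U S H) (hB : 8 * H < B) (hc : ∀ j < n, |c j| ≤ H)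
    (hi : i < m) (hj : j < n) :
    LayoutTriple m n B (RelaxState m n U S c w i j) relaxStep 13
      (RelaxState m n U S c w i (j + 1)) := by
  refine .of_wp (by decide) fun s hl hs => ?_
  have hlt := mul_add_lt hi hj
  have hU : s.mem (i * n + j) = U i j := by
    simpa only [zero_add, rowMajor_apply _ _ hj] using hs.arrays.upper _ hlt
  have hb : s.mem (2 * (m * n) + (i * n + j)) = base U S i j :=
    (hs.arrays.base _ hlt).trans (rowMajor_apply _ _ hj)
  have hcj : s.mem (3 * (m * n) + j) = c j := (hs.arrays.offsets j hj).trans (splice_of_le le_rfl)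
  simp only [relaxStep, wp, Store.setReg, Store.setMem, Function.update_apply, Nat.reduceEqDiff,
    if_true, if_false, hs.upper_eq, hs.base_eq, hs.offset_eq, hs.min_eq, Int.toNat_natCast, hU, hb,
    hcj, hl.zero, hl.one, sub_zero, abs_lt]
  have hnew : relaxRow n (base U S) U i c j =
      if 0 < c j - (rowMin (base U S) c i n - base U S i j + U i j) then
        rowMin (base U S) c i n - base U S i j + U i j else c j := by
    rw [relaxRow]
    omega
  have hmem := hs.arrays.update_offsets hj (relaxRow n (base U S) U i c j)
  rw [update_splice, hnew] at hmem
  have hmin := abs_le.1 (abs_rowMin_le le_rfl (by omega) (h.base i hi) hc)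
  have hU := abs_le.1 (h.upper i hi j hj)
  have hb := abs_le.1 (h.base i hi j hj)
  have hc := abs_le.1 (hc j hj)
  have hH := h.size
  have := Nat.le_mul_of_pos_left n (Nat.zero_lt_of_lt hi)
  repeat refine ⟨by intros; omega, ?_⟩
  exact {
    arrays := hmem
    upper_eq := (Nat.cast_succ _).symm
    base_eq := (Nat.cast_succ _).symm
    offset_eq := (Nat.cast_succ _).symm
    min_eq := hs.min_eq }

/-- The state before the relaxation with respect to row `i`. -/
structure RelaxLineState (m n : ℕ) (U S : ℕ → ℕ → ℤ) (c w : ℕ → ℤ) (i : ℕ) (s : Store) :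
    Prop where
  arrays : Arrays m n S (rowMajor n U) (rowMajor n (base U S))
    (relaxRows n (base U S) U c i) w s.mem
  upper_eq : s.reg pUpper = (i * n : ℕ)
  base_eq : s.reg pBase = (2 * (m * n) + i * n : ℕ)

theorem relaxLine_spec (h : Small m n U S H) (hB : 8 * H < B)
    (hc : ∀ j < n, |relaxRows n (base U S) U c i j| ≤ H) (hi : i < m) (hn : 0 < n) :
    LayoutTriple m n B (RelaxLineState m n U S c w i) relaxLine (n * 28 + 12)
      (RelaxLineState m n U S c w (i + 1)) := by
  have hH := h.size
  have hle := Nat.le_mul_of_pos_left n (Nat.zero_lt_of_lt hi)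
  have hmin := (minRow_spec (S := S) (a := rowMajor n U) (w := w) hH hB (h.base i hi) hc hi
    hn).frame (R := fun s => s.reg pUpper = (i * n : ℕ) ∧ s.reg pBase = (2 * (m * n) + i * n : ℕ))
    fun s s' hs ⟨h1, h2⟩ => ⟨(hs _ (by decide)).trans h1, (hs _ (by decide)).trans h2⟩
  have henter : LayoutTriple m n B (fun s => (s.reg pUpper = (i * n : ℕ) ∧
      s.reg pBase = (2 * (m * n) + i * n : ℕ)) ∧
      Arrays m n S (rowMajor n U) (rowMajor n (base U S)) (relaxRows n (base U S) U c i) w s.mem ∧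
      s.reg rMin = rowMin (base U S) (relaxRows n (base U S) U c i) i n)
      (add pOffset rOffsets rZero) 1
      (RelaxState m n U S (relaxRows n (base U S) U c i) w i 0) := by
    refine .of_wp (by decide) fun s hl ⟨⟨hupper, hbase⟩, hs, hmin⟩ => ?_
    simp only [wp, Store.setReg, hl.offsets, hl.zero, add_zero, abs_lt]
    refine ⟨by omega, ?_, hupper, hbase, rfl, hmin⟩
    rwa [splice_zero]
  have hloop := LayoutTriple.times (k := rCol)
    (I := RelaxState m n U S (relaxRows n (base U S) U c i) w i) (fun _ hl => hl.cols) (by decide)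
    (fun _ _ _ ⟨h1, h2, h3, h4, h5⟩ => ⟨h1, h2, h3, h4, h5⟩) (by decide) (by omega)
    fun j hj => relaxStep_spec h hB hc hi hj
  refine (hmin.seq (henter.seq hloop)).mono (fun s hs => ?_) (by omega) fun s hs => ?_
  · exact ⟨⟨hs.upper_eq, hs.base_eq⟩, hs.arrays, hs.base_eq⟩
  · obtain ⟨⟨h1, h2, h3, h4, h5⟩, hupper, hbase, -, -⟩ := hs
    rw [← Nat.succ_mul] at hupper hbase
    exact ⟨⟨h1, h2, h3, h4.of_splice, h5⟩, hupper, hbase⟩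

theorem relaxRound_spec (h : Small m n U S H) (hB : 8 * H < B)
    (hc : ∀ i < m, ∀ j < n, |relaxRows n (base U S) U c i j| ≤ H) (hm : 0 < m) (hn : 0 < n) :
    LayoutTriple m n B
      (fun s => Arrays m n S (rowMajor n U) (rowMajor n (base U S)) c w s.mem)
      relaxRound (m * (n * 28 + 15) + 5)
      (fun s => Arrays m n S (rowMajor n U) (rowMajor n (base U S))
        (relaxRows n (base U S) U c m) w s.mem) := by
  have hH := h.size
  have hle := Nat.le_mul_of_pos_right m hn
  have henter : LayoutTriple m n B
      (fun s => Arrays m n S (rowMajor n U) (rowMajor n (base U S)) c w s.mem)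
      (const pUpper 0 ;; add pBase rSize rSize) 2 (RelaxLineState m n U S c w 0) := by
    refine .of_wp (by decide) fun s hl hs => ?_
    simp only [wp, Store.setReg, Function.update_apply, Nat.reduceEqDiff, if_false, hl.size, abs_lt]
    repeat refine ⟨by omega, ?_⟩
    refine ⟨hs, ?_, ?_⟩ <;>
      simp only [Function.update_apply, Nat.reduceEqDiff, if_true, if_false] <;> omega
  have hloop := LayoutTriple.times (k := rRow) (I := RelaxLineState m n U S c w)
    (fun _ hl => hl.rows) (by decide) (fun _ _ _ ⟨h1, h2, h3⟩ => ⟨h1, h2, h3⟩) (by decide)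
    (by omega) fun i hi => relaxLine_spec h hB (hc i hi) hi hn
  exact (henter.seq hloop).mono (fun _ => id) (by linarith) fun s hs => hs.arrays

theorem relax_spec (h : Small m n U S H) (hB : 8 * H < B) (hm : 0 < m) (hn : 0 < n) :
    LayoutTriple m n B
      (fun s => Arrays m n S (rowMajor n U) (rowMajor n (base U S)) 0 w s.mem)
      relax (n * (m * (n * 28 + 15) + 8) + 3)
      (fun s => Arrays m n S (rowMajor n U) (rowMajor n (base U S))
        (offsets m n (base U S) U n) w s.mem) := by
  have hH := h.size
  have hle := Nat.le_mul_of_pos_left n hm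
  exact .times (I := fun t s => Arrays m n S (rowMajor n U) (rowMajor n (base U S))
      (offsets m n (base U S) U t) w s.mem)
    (fun _ hl => hl.cols) (by decide) (fun _ _ _ => id) (by decide) (by omega)
    fun t ht => relaxRound_spec h hB (fun i hi => h.offsets t ht.le i hi.le) hm hn

/-- The value of the flag after `l` comparisons of `f` and `g`. -/
def leFlag (f g : ℕ → ℤ) : ℕ → ℤ
  | 0 => 1
  | l + 1 => if 0 < f l - g l then 0 else leFlag f g l

theorem leFlag_eq (f g : ℕ → ℤ) (l : ℕ) : leFlag f g l = if ∀ x < l, f x ≤ g x then 1 else 0 := by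
  induction l with
  | zero => simp [leFlag]
  | succ l ih => grind [leFlag]

/-- The state of the last phase during the treatment of row `i` before entry `j`. -/
structure OutState (m n : ℕ) (U S : ℕ → ℕ → ℤ) (c w : ℕ → ℤ) (i j : ℕ) (s : Store) : Prop where
  arrays : Arrays m n S (splice (rowMajor n U) (rowMajor n (candidate n U S c)) (i * n + j))
    (rowMajor n (base U S)) c w s.mem
  upper_eq : s.reg pUpper = (i * n + j : ℕ)
  base_eq : s.reg pBase = (2 * (m * n) + (i * n + j) : ℕ)
  offset_eq : s.reg pOffset = (3 * (m * n) + j : ℕ)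
  rowSign_eq : s.reg rRowSign = (-1) ^ (i + 1)
  sign_eq : s.reg rSign = (-1) ^ (i + j)
  min_eq : s.reg rMin = rowMin (base U S) c i n
  ok_eq : s.reg rOk = leFlag (rowMajor n (slack n (base U S) c)) (rowMajor n U) (i * n + j)

theorem outStep_spec (h : Small m n U S H) (hB : 8 * H < B) (hc : ∀ j < n, |c j| ≤ H)
    (hi : i < m) (hj : j < n) :
    LayoutTriple m n B (OutState m n U S c w i j) outStep 17
      (OutState m n U S c w i (j + 1)) := by
  refine .of_wp (by decide) fun s hl hs => ?_
  have hlt := mul_add_lt hi hj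
  have hU : s.mem (i * n + j) = U i j := by
    simpa only [zero_add, splice_of_le le_rfl, rowMajor_apply _ _ hj] using hs.arrays.upper _ hlt
  have hb : s.mem (2 * (m * n) + (i * n + j)) = base U S i j :=
    (hs.arrays.base _ hlt).trans (rowMajor_apply _ _ hj)
  have hmem := hs.arrays.update_upper hlt (rowMajor n (candidate n U S c) (i * n + j))
  rw [update_splice, rowMajor_apply _ _ hj] at hmem
  have hslack : slack n (base U S) c i j = base U S i j + c j - rowMin (base U S) c i n := rfl
  simp only [outStep, wp, Store.setReg, Store.setMem, Function.update_apply, Nat.reduceEqDiff,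
    if_true, if_false, hs.upper_eq, hs.base_eq, hs.offset_eq, hs.min_eq, hs.sign_eq, hs.ok_eq,
    Int.toNat_natCast, hU, hb, hs.arrays.offsets j hj, hl.zero, hl.one, ← hslack, sub_zero,
    neg_one_pow_pos_iff, abs_lt]
  have hmin := abs_le.1 (abs_rowMin_le le_rfl (by omega) (h.base i hi) hc)
  have hU := abs_le.1 (h.upper i hi j hj)
  have hb := abs_le.1 (h.base i hi j hj)
  have hc := abs_le.1 (hc j hj)
  have hH := h.size
  have hsign := neg_one_pow_eq_or ℤ (i + j)
  have := Nat.le_mul_of_pos_left n (Nat.zero_lt_of_lt hi)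
  repeat refine ⟨by intros; omega, ?_⟩
  exact {
    arrays := hmem
    upper_eq := (Nat.cast_succ _).symm
    base_eq := (Nat.cast_succ _).symm
    offset_eq := (Nat.cast_succ _).symm
    rowSign_eq := hs.rowSign_eq
    sign_eq := (zero_sub _).trans (by ring)
    min_eq := hs.min_eq
    ok_eq := by
      simp only [Function.update_apply, Nat.reduceEqDiff, if_true, if_false]
      rw [← add_assoc, leFlag, rowMajor_apply _ _ hj, rowMajor_apply _ _ hj] }

/-- The state of the last phase before row `i`. -/
structure OutRowState (m n : ℕ) (U S : ℕ → ℕ → ℤ) (c w : ℕ → ℤ) (i : ℕ) (s : Store) : Prop where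
  arrays : Arrays m n S (splice (rowMajor n U) (rowMajor n (candidate n U S c)) (i * n))
    (rowMajor n (base U S)) c w s.mem
  upper_eq : s.reg pUpper = (i * n : ℕ)
  base_eq : s.reg pBase = (2 * (m * n) + i * n : ℕ)
  rowSign_eq : s.reg rRowSign = (-1) ^ i
  ok_eq : s.reg rOk = leFlag (rowMajor n (slack n (base U S) c)) (rowMajor n U) (i * n)

theorem outRow_enter_spec (h : Small m n U S H) (hB : 8 * H < B) (hc : ∀ j < n, |c j| ≤ H)
    (hi : i < m) (hn : 0 < n) :
    LayoutTriple m n B (OutRowState m n U S c w i)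
      (minRow ;; (add rSign rRowSign rZero ;; sub rRowSign rZero rRowSign ;;
        add pOffset rOffsets rZero))
      (n * 12 + 11) (OutState m n U S c w i 0) := by
  have hH := h.size
  have hle := Nat.le_mul_of_pos_left n (Nat.zero_lt_of_lt hi)
  have hsign := neg_one_pow_eq_or ℤ i
  have hmin := (minRow_spec (S := S)
    (a := splice (rowMajor n U) (rowMajor n (candidate n U S c)) (i * n)) (w := w) hH hB
    (h.base i hi) hc hi hn).frame (R := fun s => s.reg pUpper = (i * n : ℕ) ∧
      s.reg pBase = (2 * (m * n) + i * n : ℕ) ∧ s.reg rRowSign = (-1) ^ i ∧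
      s.reg rOk = leFlag (rowMajor n (slack n (base U S) c)) (rowMajor n U) (i * n))
    fun s s' hs ⟨h1, h2, h3, h4⟩ => ⟨(hs _ (by decide)).trans h1, (hs _ (by decide)).trans h2,
      (hs _ (by decide)).trans h3, (hs _ (by decide)).trans h4⟩
  refine (hmin.seq (.of_wp (by decide) fun s hl hs => ?_)).mono (fun s hs => ?_) le_rfl
    fun _ => id
  · obtain ⟨⟨hupper, hbase, hrow, hok⟩, hs, hmin⟩ := hs
    simp only [wp, Store.setReg, Function.update_apply, Nat.reduceEqDiff, if_false, hrow, hl.zero,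
      hl.offsets, add_zero, abs_lt]
    repeat refine ⟨by omega, ?_⟩
    exact ⟨hs, hupper, hbase, rfl, (zero_sub _).trans (by ring), rfl, hmin, hok⟩
  · exact ⟨⟨hs.upper_eq, hs.base_eq, hs.rowSign_eq, hs.ok_eq⟩, hs.arrays, hs.base_eq⟩

theorem outRow_spec (h : Small m n U S H) (hB : 8 * H < B) (hc : ∀ j < n, |c j| ≤ H)
    (hi : i < m) (hn : 0 < n) :
    LayoutTriple m n B (OutRowState m n U S c w i) outRow (n * 32 + 14)
      (OutRowState m n U S c w (i + 1)) := by
  have hH := h.size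
  have hle := Nat.le_mul_of_pos_left n (Nat.zero_lt_of_lt hi)
  have hloop := LayoutTriple.times (k := rCol) (I := OutState m n U S c w i)
    (fun _ hl => hl.cols) (by decide)
    (fun _ _ _ ⟨h1, h2, h3, h4, h5, h6, h7, h8⟩ => ⟨h1, h2, h3, h4, h5, h6, h7, h8⟩)
    (by decide) (by omega) fun j hj => outStep_spec h hB hc hi hj
  refine ((outRow_enter_spec h hB hc hi hn).seq hloop).mono (fun _ => id) (by omega)
    fun s hs => ?_
  obtain ⟨hmem, hupper, hbase, -, hrow, -, -, hok⟩ := hs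
  rw [← Nat.succ_mul] at hmem hupper hbase hok
  exact ⟨hmem, hupper, hbase, hrow, hok⟩

theorem out_spec (h : Small m n U S H) (hB : 8 * H < B) (hc : ∀ j < n, |c j| ≤ H)
    (hm : 0 < m) (hn : 0 < n) :
    LayoutTriple m n B
      (fun s => Arrays m n S (rowMajor n U) (rowMajor n (base U S)) c w s.mem)
      out (m * (n * 32 + 17) + 7)
      (fun s => HoldsAt s.mem 0 (m * n) (rowMajor n (candidate n U S c)) ∧
        s.reg rOk = leFlag (rowMajor n (slack n (base U S) c)) (rowMajor n U) (m * n)) := by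
  have hH := h.size
  have hle := Nat.le_mul_of_pos_right m hn
  have henter : LayoutTriple m n B
      (fun s => Arrays m n S (rowMajor n U) (rowMajor n (base U S)) c w s.mem)
      (const pUpper 0 ;; add pBase rSize rSize ;; const rRowSign 1 ;; const rOk 1) 4
      (OutRowState m n U S c w 0) := by
    refine .of_wp (by decide) fun s hl hs => ?_
    simp only [wp, Store.setReg, Function.update_apply, Nat.reduceEqDiff, if_false, hl.size, abs_lt]
    repeat refine ⟨by omega, ?_⟩
    refine ⟨?_, ?_, ?_, rfl, ?_⟩
    · rwa [zero_mul, splice_zero]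
    all_goals
      simp only [Function.update_apply, Nat.reduceEqDiff, if_true, if_false, zero_mul, leFlag]
    all_goals omega
  have hloop := LayoutTriple.times (k := rRow) (I := OutRowState m n U S c w)
    (fun _ hl => hl.rows) (by decide)
    (fun _ _ _ ⟨h1, h2, h3, h4, h5⟩ => ⟨h1, h2, h3, h4, h5⟩) (by decide) (by omega)
    fun i hi => outRow_spec h hB hc hi hn
  exact (henter.seq hloop).mono (fun _ => id) (by linarith)
    fun s hs => ⟨hs.arrays.upper.of_splice, hs.ok_eq⟩

/-- The store at the start of the program. -/
structure InitialStore (m n : ℕ) (U S : ℕ → ℕ → ℤ) (s : Store) : Prop where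
  rows_eq : s.reg rM = m
  cols_eq : s.reg rN = n
  reg_eq : ∀ r > rN, s.reg r = 0
  arrays : Arrays m n S (rowMajor n U) 0 0 0 s.mem

/-- The state before step `i` of the computation of `m * n`. -/
structure SetupState (m n : ℕ) (U S : ℕ → ℕ → ℤ) (i : ℕ) (s : Store) : Prop where
  rows_eq : s.reg rM = m
  cols_eq : s.reg rN = n
  zero_eq : s.reg rZero = 0
  one_eq : s.reg rOne = 1
  size_eq : s.reg rSize = (i * n : ℕ)
  arrays : Arrays m n S (rowMajor n U) 0 0 0 s.mem

theorem setup_spec (hH : (8 * (m * n) : ℕ) ≤ H) (hB : 8 * H < B) (hm : 0 < m) (hn : 0 < n) :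
    Triple B (InitialStore m n U S) setup (m * 4 + 7)
      (fun s => Layout m n s ∧ Arrays m n S (rowMajor n U) 0 0 0 s.mem) := by
  have hle := Nat.le_mul_of_pos_right m hn
  have hle' := Nat.le_mul_of_pos_left n hm
  have henter : Triple B (InitialStore m n U S) (const rOne 1) 1 (SetupState m n U S 0) := by
    refine .of_wp fun s hs => ⟨by rw [abs_lt]; omega, ?_⟩
    exact ⟨hs.rows_eq, hs.cols_eq, hs.reg_eq _ (by decide), rfl,
      (hs.reg_eq rSize (by decide)).trans (by simp), hs.arrays⟩
  have hbody : ∀ i < m, Triple B (SetupState m n U S i) (add rSize rSize rN) 1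
      (SetupState m n U S (i + 1)) := by
    refine fun i hi => .of_wp fun s hs => ?_
    have := Nat.mul_le_mul_right n hi
    simp only [wp, hs.size_eq, hs.cols_eq, abs_lt]
    rw [Nat.succ_mul] at this
    refine ⟨by omega, hs.rows_eq, hs.cols_eq, hs.zero_eq, hs.one_eq, ?_, hs.arrays⟩
    rw [Nat.succ_mul]
    exact (Nat.cast_add _ _).symm
  have hexit : Triple B (SetupState m n U S m)
      (add rOffsets rSize rSize ;; add rOffsets rOffsets rSize ;; add rBuffer rOffsets rN) 3
      (fun s => Layout m n s ∧ Arrays m n S (rowMajor n U) 0 0 0 s.mem) := by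
    refine .of_wp fun s ⟨h1, h2, h3, h4, h5, h6⟩ => ?_
    simp only [wp, Store.setReg, Function.update_apply, Nat.reduceEqDiff, if_true, if_false, h2, h5,
      abs_lt]
    repeat refine ⟨by omega, ?_⟩
    refine ⟨⟨h1, h2, h3, h4, h5, ?_, ?_⟩, h6⟩ <;>
      simp only [Function.update_apply, Nat.reduceEqDiff, if_true, if_false] <;> omega
  have hloop := Triple.times (k := rRow) (b := rM) (I := SetupState m n U S)
    (fun i s hs => ⟨hs.zero_eq, hs.one_eq, hs.rows_eq⟩)
    (fun _ _ _ ⟨h1, h2, h3, h4, h5, h6⟩ => ⟨h1, h2, h3, h4, h5, h6⟩) (by decide) (by omega) hbody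
  exact (henter.seq (hloop.seq hexit)).mono (fun _ => id) (by omega) fun _ => id

/-- The store at the end of the program. -/
structure FinalStore (m n : ℕ) (U S : ℕ → ℕ → ℤ) (s : Store) : Prop where
  output : HoldsAt s.mem 0 (m * n) (rowMajor n (candidate n U S (offsets m n (base U S) U n)))
  flag : s.reg rM =
    leFlag (rowMajor n (slack n (base U S) (offsets m n (base U S) U n))) (rowMajor n U) (m * n)

theorem main_spec (h : Small m n U S H) (hB : 8 * H < B) (hm : 0 < m) (hn : 0 < n) :
    Triple B (InitialStore m n U S) main (159 * (m * n * n)) (FinalStore m n U S) := by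
  have hc : ∀ j < n, |offsets m n (base U S) U n j| ≤ H := h.offsets n le_rfl 0 (Nat.zero_le m)
  have hmain := (fill_spec h hB hm hn).seq ((relax_spec h hB hm hn).seq (out_spec h hB hc hm hn))
  refine ((setup_spec h.size hB hm hn).seq (Triple.seq hmain (.of_wp (Q := FinalStore m n U S)
    fun s ⟨hl, hs, hok⟩ => ?_))).mono (fun _ => id) ?_ fun _ => id
  · simp only [wp, hl.zero, add_zero, hok]
    refine ⟨?_, hs, rfl⟩
    have hH := h.size
    have hpos := Nat.mul_pos hm hn
    rw [leFlag_eq, abs_lt]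
    split_ifs <;> omega
  · have h1 := Nat.le_mul_of_pos_right (m * n) hn
    have h2 := Nat.le_mul_of_pos_right m hn
    have h3 := Nat.le_mul_of_pos_left n hm
    change _ + (_ + 1) ≤ _
    ring_nf at h1 ⊢
    linarith

end Correctness

end Machine

/-! ### The input and the output -/

section Instance

variable {m n k l : ℕ}

theorem apply_divNat_modNat (A : Matrix (Fin k) (Fin l) ℤ) (i : Fin k) (j : Fin l)
    (h : i * l + j < k * l) :
    A (Fin.divNat ⟨i * l + j, h⟩) (Fin.modNat ⟨i * l + j, h⟩) = A i j := by
  have hij : (⟨i * l + j, h⟩ : Fin (k * l)) = finProdFinEquiv (i, j) :=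
    Fin.ext (by simp [add_comm, mul_comm])
  have := finProdFinEquiv.symm_apply_apply (i, j)
  rw [hij]
  exact congrArg₂ A (congrArg Prod.fst this) (congrArg Prod.snd this)

theorem le_maxAbs (A : Matrix (Fin k) (Fin l) ℤ) (i : Fin k) (j : Fin l) : |A i j| ≤ maxAbs A := by
  rw [Int.abs_eq_natAbs]
  exact_mod_cast Finset.le_sup (f := fun ij : Fin k × Fin l => (A ij.1 ij.2).natAbs)
    (Finset.mem_univ (i, j))

theorem inputMem_upper (U : Matrix (Fin m) (Fin n) ℤ) (S : Matrix (Fin k) (Fin l) ℤ) (i : Fin m)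
    (j : Fin n) : inputMem U S (i * n + j) = U i j := by
  rw [inputMem, dif_pos (mul_add_lt i.2 j.2)]
  exact apply_divNat_modNat U i j _

theorem inputMem_sums (U : Matrix (Fin m) (Fin n) ℤ) (S : Matrix (Fin k) (Fin l) ℤ) (i : Fin k)
    (j : Fin l) : inputMem U S (m * n + (i * l + j)) = S i j := by
  have hlt := mul_add_lt i.2 j.2
  rw [inputMem, dif_neg (by omega), dif_pos (by omega)]
  simp only [Nat.add_sub_cancel_left]
  exact apply_divNat_modNat S i j hlt

theorem inputMem_eq_zero (U : Matrix (Fin m) (Fin n) ℤ) (S : Matrix (Fin k) (Fin l) ℤ) {a : ℕ}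
    (ha : m * n + k * l ≤ a) : inputMem U S a = 0 := by
  rw [inputMem, dif_neg (by omega), dif_neg (by omega)]

theorem abs_inputMem_le (U : Matrix (Fin m) (Fin n) ℤ) (S : Matrix (Fin k) (Fin l) ℤ) (a : ℕ) :
    |inputMem U S a| ≤ maxAbs U + maxAbs S := by
  rw [inputMem]
  split_ifs
  · exact (le_maxAbs U _ _).trans (by omega)
  · exact (le_maxAbs S _ _).trans (by omega)
  · rw [abs_zero]
    positivity

theorem windowSum_two_two (A : Matrix (Fin m) (Fin n) ℤ) (i : Fin (m + 1 - 2))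
    (j : Fin (n + 1 - 2)) :
    windowSum 2 2 A i j = A ⟨i, by omega⟩ ⟨j, by omega⟩ + A ⟨i + 1, by omega⟩ ⟨j, by omega⟩ +
      A ⟨i, by omega⟩ ⟨j + 1, by omega⟩ + A ⟨i + 1, by omega⟩ ⟨j + 1, by omega⟩ := by
  simp only [windowSum, Fin.sum_univ_two, Fin.val_zero, Fin.val_one, add_zero]
  ring

variable (U : Matrix (Fin m) (Fin n) ℤ) (S : Matrix (Fin (m + 1 - 2)) (Fin (n + 1 - 2)) ℤ)

/-- The upper bounds, read from the memory in order to have indices in `ℕ`. -/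
def upperEntry (i j : ℕ) : ℤ := inputMem U S (i * n + j)

/-- The window sums, read from the memory in order to have indices in `ℕ`; the values for
`j = n - 1` are meaningless. -/
def sumEntry (i j : ℕ) : ℤ := inputMem U S (m * n + (i * (n - 1) + j))

variable {U S}

theorem sumEntry_apply (i : Fin (m + 1 - 2)) (j : Fin (n + 1 - 2)) : sumEntry U S i j = S i j :=
  inputMem_sums U S i j

theorem isSolution_iff_solves {A : Matrix (Fin m) (Fin n) ℤ} {f : ℕ → ℕ → ℤ}
    (hf : ∀ i j, A i j = f i j) :
    IsSolution U S A ↔ Solves m n (upperEntry U S) (sumEntry U S) f := by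
  have hU (i : Fin m) (j : Fin n) : upperEntry U S i j = U i j := inputMem_upper U S i j
  constructor
  · rintro ⟨hbounds, rfl⟩
    refine ⟨fun i hi j hj => ?_, fun i j hi hj => ?_⟩
    · simpa only [hf, ← hU] using hbounds ⟨i, hi⟩ ⟨j, hj⟩
    · refine .trans ?_ (sumEntry_apply ⟨i, by omega⟩ ⟨j, by omega⟩).symm
      simp only [windowSum_two_two, hf]
  · intro h
    refine ⟨fun i j => ?_, ?_⟩
    · simpa only [hf, ← hU] using h.bounds i i.2 j j.2
    · ext i j
      rw [windowSum_two_two, hf, hf, hf, hf]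
      exact (h.window i j (by omega) (by omega)).trans (sumEntry_apply i j)

theorem FinalStore.answers {s : Store} (h : FinalStore m n (upperEntry U S) (sumEntry U S) s)
    (hn : 0 < n) (b : ℕ) : Answers U S (s.withPC b) := by
  have hflag := h.flag
  rw [leFlag_eq] at hflag
  split_ifs at hflag with hle
  · have houtput (i : Fin m) (j : Fin n) :=
      (h.output _ (mul_add_lt i.2 j.2)).trans (rowMajor_apply _ i j.2)
    simp only [zero_add] at houtput
    refine .inl ⟨hflag, (isSolution_iff_solves houtput).2 <|
      solves_candidate fun i hi j hj => ?_⟩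
    have := hle _ (mul_add_lt hi hj)
    rwa [rowMajor_apply _ i hj, rowMajor_apply _ i hj] at this
  · refine .inr ⟨hflag, fun ⟨A, hA⟩ => hle fun x hx => ?_⟩
    have hsolves := (isSolution_iff_solves
      (f := fun i j => if h : i < m ∧ j < n then A ⟨i, h.1⟩ ⟨j, h.2⟩ else 0) (by simp)).1 hA
    exact hsolves.slack_offsets_le (Nat.div_lt_of_lt_mul (by rwa [mul_comm])) (Nat.mod_lt x hn)

theorem initialStore_inputConfig :
    InitialStore m n (upperEntry U S) (sumEntry U S)
      ⟨(inputConfig U S).reg, (inputConfig U S).mem⟩ := by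
  have hle : (m + 1 - 2) * (n + 1 - 2) ≤ m * n := Nat.mul_le_mul (by omega) (by omega)
  refine ⟨rfl, rfl, fun r hr => ?_, fun x _ => ?_, fun _ _ _ _ => rfl, ?_, ?_, ?_⟩
  · exact (if_neg (by omega)).trans (if_neg (by omega))
  · rw [rowMajor, upperEntry, Nat.div_add_mod', zero_add]
    rfl
  all_goals exact fun x _ => inputMem_eq_zero U S (by omega)

end Instance

/-! ### Word size and running time -/

section Bounds

theorem small_pow {m n : ℕ} {U S : ℕ → ℕ → ℤ} {N : ℤ} (hN : 2 ≤ N) (hm : m ≤ N) (hn : n ≤ N)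
    (hU : ∀ i j, |U i j| ≤ N) (hS : ∀ i j, |S i j| ≤ N) : Small m n U S (N ^ 10) := by
  have hpow {a : ℕ} (b : ℕ) (h : a ≤ b) : N ^ a ≤ N ^ b := pow_le_pow_right₀ (by omega) h
  have hN0 : 0 ≤ N := by omega
  have hle : N ≤ N ^ 10 := le_self_pow₀ (by omega) (by omega)
  have hpair : ∀ i, ∀ j < n, |pairSum S i j| ≤ N ^ 2 := fun i j hj =>
    calc |pairSum S i j| ≤ j * N := abs_pairSum_le (hS i) j
      _ ≤ N * N := by gcongr; omega
      _ = N ^ 2 := by ring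
  have hpart : ∀ i < m, ∀ j < n, |particular S i j| ≤ N ^ 3 := fun i hi j hj =>
    calc |particular S i j| ≤ i * (j * N) := abs_particular_le hS i j
      _ ≤ N * (N * N) := by gcongr <;> omega
      _ = N ^ 3 := by ring
  have hbase : ∀ i < m, ∀ j < n, |base U S i j| ≤ N ^ 4 := fun i hi j hj =>
    calc |base U S i j| ≤ N + N ^ 3 := abs_base_le (hU i j) (hpart i hi j hj)
      _ ≤ 2 * N ^ 3 := by linarith [le_self_pow₀ (by omega : 1 ≤ N) (by omega : 3 ≠ 0)]
      _ ≤ N * N ^ 3 := by gcongr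
      _ = N ^ 4 := by ring
  have hU' : ∀ i < m, ∀ j < n, |U i j| ≤ N ^ 4 := fun i _ j _ =>
    (hU i j).trans (le_self_pow₀ (by omega) (by omega))
  refine ⟨?_, fun i _ j _ => (hU i j).trans hle, fun i _ j _ => (hS i j).trans hle,
    fun i _ j hj => (hpair i j hj).trans (hpow 10 (by omega)),
    fun i hi j hj => (hpart i hi j hj).trans (hpow 10 (by omega)),
    fun i hi j hj => (hbase i hi j hj).trans (hpow 10 (by omega)), fun t ht i hi j hj => ?_⟩
  · calc ((8 * (m * n) : ℕ) : ℤ) = 2 ^ 3 * (m * n) := by push_cast; ring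
      _ ≤ N ^ 3 * (N * N) := by gcongr
      _ = N ^ 5 := by ring
      _ ≤ N ^ 10 := hpow 10 (by omega)
  · calc |relaxRows n (base U S) U (offsets m n (base U S) U t) i j|
        ≤ t * (m * (3 * N ^ 4)) + i * (3 * N ^ 4) :=
          abs_relaxRows_le hbase hU' (fun j hj => abs_offsets_le hbase hU' t hj) hi hj
      _ ≤ N * (N * (3 * N ^ 4)) + N * (3 * N ^ 4) := by gcongr <;> omega
      _ = 3 * N ^ 6 + 3 * N ^ 5 := by ring
      _ ≤ 2 ^ 4 * N ^ 6 := by linarith [hpow 6 (show 5 ≤ 6 by omega), pow_nonneg hN0 6]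
      _ ≤ N ^ 4 * N ^ 6 := by gcongr
      _ = N ^ 10 := by ring

variable {m n : ℕ} (U : Matrix (Fin m) (Fin n) ℤ)
  (S : Matrix (Fin (m + 1 - 2)) (Fin (n + 1 - 2)) ℤ)

theorem small_inputMem (hm : 0 < m) (hn : 0 < n) :
    Small m n (upperEntry U S) (sumEntry U S) ((m + n + maxAbs U + maxAbs S) ^ 10) := by
  refine small_pow (by omega) (by omega) (by omega) ?_ ?_ <;>
    exact fun _ _ => (abs_inputMem_le U S _).trans (by omega)

theorem eight_mul_pow_lt (hm : 0 < m) (hn : 0 < n) :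
    8 * ((m + n + maxAbs U + maxAbs S : ℤ) ^ 10) < 2 ^ (14 * instanceBits U S) := by
  set N := m + n + maxAbs U + maxAbs S
  have hlt : N ^ 14 < 2 ^ (14 * instanceBits U S) := by
    rw [instanceBits, mul_comm, pow_mul]
    exact Nat.pow_lt_pow_left (Nat.lt_size_self N) (by omega)
  have hle : 8 * N ^ 10 ≤ N ^ 14 :=
    calc 8 * N ^ 10 ≤ 2 ^ 4 * N ^ 10 := by omega
      _ ≤ N ^ 4 * N ^ 10 := by gcongr; omega
      _ = N ^ 14 := by ring
  exact_mod_cast hle.trans_lt hlt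

/-- The program that solves the reconstruction problem. -/
def program : Program := main.code 0 ++ [.halt]

theorem program_haltsIn (hm : 0 < m) (hn : 0 < n) :
    ∃ T c, HaltsIn program (14 * instanceBits U S) (inputConfig U S) T c ∧ Answers U S c ∧
      T ≤ 159 * (m * n * n) := by
  have hB := eight_mul_pow_lt U S hm hn
  have hbounded : Store.Bounded (2 ^ (14 * instanceBits U S))
      ⟨(inputConfig U S).reg, (inputConfig U S).mem⟩ := by
    have hN := le_self_pow₀ (a := (m + n + maxAbs U + maxAbs S : ℤ)) (by omega)
      (show 10 ≠ 0 by omega)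
    refine ⟨fun r => ?_, fun a => (abs_inputMem_le U S a).trans_lt (by omega)⟩
    simp only [inputConfig, abs_lt]
    split_ifs <;> omega
  obtain ⟨T, hT, s, hexec, hfinal⟩ :=
    main_spec (small_inputMem U S hm hn) hB hm hn _ initialStore_inputConfig
  have hreach := hexec.reaches hbounded 0 ⟨[], [.halt], rfl, rfl⟩
  refine ⟨T, _, ⟨hreach.1, ?_, hreach.2⟩, hfinal.answers hn _, hT⟩
  rw [zero_add, ← Cmd.length_code main 0]
  exact List.getElem?_concat_length

theorem mul_le_unaryLength : m * n ≤ unaryLength U S :=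
  calc m * n = ∑ _i : Fin m, ∑ _j : Fin n, 1 := by simp
    _ ≤ ∑ i, ∑ j, ((U i j).natAbs + 1) := by gcongr; omega
    _ ≤ unaryLength U S := Nat.le_add_right _ _

theorem mul_mul_le_unaryLength_sq (hm : 0 < m) : m * n * n ≤ unaryLength U S ^ 2 :=
  calc m * n * n ≤ m * n * (m * n) := Nat.mul_le_mul_left _ (Nat.le_mul_of_pos_left n hm)
    _ = (m * n) ^ 2 := (sq _).symm
    _ ≤ unaryLength U S ^ 2 := Nat.pow_le_pow_left (mul_le_unaryLength U S) 2

end Bounds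

end WindowSums

theorem theorem2_general :
    ∃ (p : WindowSums.Program) (C k : ℕ), ∀ (m n : ℕ), 0 < m → 0 < n →
      ∀ (U : Matrix (Fin m) (Fin n) ℤ) (S : Matrix (Fin (m + 1 - 2)) (Fin (n + 1 - 2)) ℤ),
        ∃ (T : ℕ) (c : WindowSums.Config),
          WindowSums.HaltsIn p (k * WindowSums.instanceBits U S)
            (WindowSums.inputConfig U S) T c ∧
          WindowSums.Answers U S c ∧ T ≤ C * (m * n * n) :=
  ⟨WindowSums.program, 159, 14, fun _ _ hm hn U S => WindowSums.program_haltsIn U S hm hn⟩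

theorem theorem2 :
    ∃ (p : WindowSums.Program) (C k : ℕ) (q : Polynomial ℕ),
      ∀ (m n : ℕ) (hm : 0 < m) (hn : 0 < n) (U : Matrix (Fin m) (Fin n) ℤ)
        (S : Matrix (Fin (m + 1 - 2)) (Fin (n + 1 - 2)) ℤ),
        ∃ (T : ℕ) (c : WindowSums.Config),
          WindowSums.HaltsIn p (k * WindowSums.instanceBits U S)
            (WindowSums.inputConfig U S) T c ∧
          WindowSums.Answers U S c ∧
          T ≤ C * (m * n * (m + n) * (1 + (WindowSums.minEntry hm hn U).toNat)) ∧
          T ≤ q.eval (WindowSums.unaryLength U S) := by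
  obtain ⟨p, C, k, hp⟩ := theorem2_general
  refine ⟨p, C, k, .C C * .X ^ 2, fun m n hm hn U S => ?_⟩
  obtain ⟨T, c, hc, ha, hT⟩ := hp m n hm hn U S
  refine ⟨T, c, hc, ha, hT.trans (Nat.mul_le_mul_left C ?_), hT.trans ?_⟩
  · exact (Nat.mul_le_mul_left (m * n) (Nat.le_add_left n m)).trans
      (Nat.le_mul_of_pos_right _ (by omega))
  · simpa using Nat.mul_le_mul_left C (WindowSums.mul_mul_le_unaryLength_sq U S hm)
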